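/- Let $k$ be a field and let $E=(E^0,E^1,r,s)$ be a row-finite directed graph (every vertex emits finitely many edges; $E^0$, $E^1$ may be infinite). Let $S$ be the set of sinks, $R=E^0\setminus S$, and let $A_E=\begin{pmatrix}B&C\\0&0\end{pmatrix}$ be the adjacency matrix of $E$ with respect to $E^0=R\sqcup S$, whose $(v,w)$-entry is the number of edges from $v$ to $w$. For a set $X$ write $\mathbb Z^X=\bigoplus_X\mathbb Z$. Let $L(E)=L_k(E)$ be the Leavitt path algebra, i.e. the (not necessarily unital) $k$-algebra generated by $E^0\cup E^1\cup\{e^*: e\in E^1\}$ with relations $vw=\delta_{v,w}v$, $s(e)e=e=e\,r(e)$, $r(e)e^*=e^*=e^*s(e)$, $e^*f=\delta_{e,f}r(e)$ and $v=\sum_{s(e)=v}ee^*$ for $v\in R$, graded over $\mathbb Z$ by $\deg v=0$, $\deg e=1$, $\deg e^*=-1$. Let $K_0^{\mathrm{gr}}(L(E))$ be the group completion of the monoid $\mathcal V^{\mathrm{gr}}(L(E))$ of equivalence classes of homogeneous idempotent matrices over $L(E)$ (that is, of isomorphism classes of graded finitely generated projective left modules). For a graded module $P$ let $P(n)_d=P_{d+n}$,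 and put $v(i)=[(L(E)v)(-i)]\in K_0^{\mathrm{gr}}(L(E))$ for $v\in E^0$, $i\in\mathbb Z$. Let $\phi$ be the endomorphism of the group $K_0^{\mathrm{gr}}(L(E))$ with $\phi([P])=[P(-1)]-[P]$; it is the unique endomorphism with $\phi(v(i))=v(i+1)-v(i)$ for all $v\in E^0$, $i\in\mathbb Z$. Define $$K:\mathbb Z^R\to\mathbb Z^R\oplus\mathbb Z^S,\quad K(x)=\big((B^t-I)x,\;C^tx\big),\qquad \psi:\mathbb Z^R\oplus\mathbb Z^S\to K_0^{\mathrm{gr}}(L(E)),\quad \psi\Big(\sum_i n_iv_i\Big)=\sum_i n_i\,v_i(0),$$ and regard $\mathbb Z^R$ as a subgroup of $\mathbb Z^R\oplus\mathbb Z^S$ by $x\mapsto(x,0)$. Then $\psi$ restricts to an isomorphism $\psi|:\operatorname{Ker}K\to\operatorname{Ker}\phi$ and induces an isomorphism $\overline\psi:\operatorname{Coker}K\to\operatorname{Coker}\phi$, such that the following diagram commutes, where the unlabelled maps are the inclusions and the quotient maps: $$\begin{array}{ccccccc} \operatorname{Ker}K&\to&\mathbb Z^R&\xrightarrow{\;K\;}&\mathbb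 Z^R\oplus\mathbb Z^S&\to&\operatorname{Coker}K\\ \downarrow{\scriptstyle\psi|}&&\downarrow{\scriptstyle\psi}&&\downarrow{\scriptstyle\psi}&&\downarrow{\scriptstyle\overline\psi}\\ \operatorname{Ker}\phi&\to&K_0^{\mathrm{gr}}(L(E))&\xrightarrow{\;\phi\;}&K_0^{\mathrm{gr}}(L(E))&\to&\operatorname{Coker}\phi \end{array}$$ -/

import Mathlib

/-! ### Graded Grothendieck groups of (not necessarily unital) `ℤ`-graded rings -/

namespace GradedK

section Matrices

variable {A : Type*} [NonUnitalRing A] (𝒜 : ℤ → AddSubgroup A)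

/-- A matrix `M` with rows shifted by `δ` and columns shifted by `ε` is homogeneous (of degree `0`)
if its `(i, j)` entry has degree `δ i - ε j`.  For unital `A` these are, by right multiplication on
row vectors, the degree preserving maps `⨁ i, A(-δ i) → ⨁ j, A(-ε j)` of graded left modules. -/
def IsHomog {m n : Type*} (δ : m → ℤ) (ε : n → ℤ) (M : Matrix m n A) : Prop :=
  ∀ i j, M i j ∈ 𝒜 (δ i - ε j)

/-- Graded (Murray–von Neumann) equivalence of homogeneous idempotent matrices. -/
def MvN {m n : Type*} [Fintype m] [Fintype n] (δ : m → ℤ) (M : Matrix m m A)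
    (ε : n → ℤ) (N : Matrix n n A) : Prop :=
  ∃ (x : Matrix m n A) (y : Matrix n m A),
    IsHomog 𝒜 δ ε x ∧ IsHomog 𝒜 ε δ y ∧ x * y = M ∧ y * x = N

variable {𝒜}

theorem IsHomog.mul [SetLike.GradedMul 𝒜] {m n p : Type*} [Fintype n] {δ : m → ℤ} {ε : n → ℤ}
    {η : p → ℤ} {M : Matrix m n A} {N : Matrix n p A} (hM : IsHomog 𝒜 δ ε M)
    (hN : IsHomog 𝒜 ε η N) : IsHomog 𝒜 δ η (M * N) := by
  intro i j
  rw [Matrix.mul_apply]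
  refine AddSubgroup.sum_mem _ fun l _ => ?_
  have h := SetLike.GradedMul.mul_mem (hM i l) (hN l j)
  rwa [sub_add_sub_cancel] at h

theorem IsHomog.fromBlocks {m n m' n' : Type*} {δ : m → ℤ} {ε : n → ℤ} {δ' : m' → ℤ} {ε' : n' → ℤ}
    {M : Matrix m n A} {N : Matrix m' n' A} (hM : IsHomog 𝒜 δ ε M) (hN : IsHomog 𝒜 δ' ε' N) :
    IsHomog 𝒜 (Sum.elim δ δ') (Sum.elim ε ε') (Matrix.fromBlocks M 0 0 N) := by
  rintro (i | i) (j | j)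
  · exact hM i j
  · exact zero_mem _
  · exact zero_mem _
  · exact hN i j

theorem MvN.symm {m n : Type*} [Fintype m] [Fintype n] {δ : m → ℤ} {M : Matrix m m A}
    {ε : n → ℤ} {N : Matrix n n A} (h : MvN 𝒜 δ M ε N) : MvN 𝒜 ε N δ M := by
  obtain ⟨x, y, hx, hy, h1, h2⟩ := h
  exact ⟨y, x, hy, hx, h2, h1⟩

theorem MvN.trans [SetLike.GradedMul 𝒜] {m n p : Type*} [Fintype m] [Fintype n] [Fintype p]
    {δ : m → ℤ} {M : Matrix m m A} {ε : n → ℤ} {N : Matrix n n A} {η : p → ℤ} {P : Matrix p p A}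
    (hM : M * M = M) (hP : P * P = P) (h : MvN 𝒜 δ M ε N) (h' : MvN 𝒜 ε N η P) :
    MvN 𝒜 δ M η P := by
  obtain ⟨x, y, hx, hy, h1, h2⟩ := h
  obtain ⟨z, w, hz, hw, h3, h4⟩ := h'
  refine ⟨x * z, w * y, hx.mul hz, hw.mul hy, ?_, ?_⟩
  · calc x * z * (w * y) = x * (z * w) * y := by simp only [Matrix.mul_assoc]
      _ = (x * y) * (x * y) := by rw [h3, ← h2]; simp only [Matrix.mul_assoc]
      _ = M := by rw [h1, hM]
  · calc w * y * (x * z) = w * (y * x) * z := by simp only [Matrix.mul_assoc]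
      _ = (w * z) * (w * z) := by rw [h2, ← h3]; simp only [Matrix.mul_assoc]
      _ = P := by rw [h4, hP]

theorem MvN.reindex {m n : Type*} [Fintype m] [Fintype n] (e : n ≃ m) {δ : m → ℤ}
    {M : Matrix m m A} (hh : IsHomog 𝒜 δ δ M) (hM : M * M = M) :
    MvN 𝒜 (δ ∘ e) (M.submatrix e e) δ M := by
  refine ⟨M.submatrix e id, M.submatrix id e, fun i j => hh _ _, fun i j => hh _ _, ?_, ?_⟩
  · rw [← Matrix.submatrix_mul _ _ _ _ _ Function.bijective_id, hM]
  · rw [← Matrix.submatrix_mul _ _ _ _ _ e.bijective, hM, Matrix.submatrix_id_id]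

theorem MvN.refl {m : Type*} [Fintype m] {δ : m → ℤ}
    {M : Matrix m m A} (hh : IsHomog 𝒜 δ δ M) (hM : M * M = M) : MvN 𝒜 δ M δ M :=
  MvN.reindex (Equiv.refl m) hh hM

theorem MvN.fromBlocks {m n m' n' : Type*} [Fintype m] [Fintype n] [Fintype m'] [Fintype n']
    {δ : m → ℤ} {M : Matrix m m A} {ε : n → ℤ} {N : Matrix n n A}
    {δ' : m' → ℤ} {M' : Matrix m' m' A} {ε' : n' → ℤ} {N' : Matrix n' n' A}
    (h : MvN 𝒜 δ M ε N) (h' : MvN 𝒜 δ' M' ε' N') :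
    MvN 𝒜 (Sum.elim δ δ') (Matrix.fromBlocks M 0 0 M')
      (Sum.elim ε ε') (Matrix.fromBlocks N 0 0 N') := by
  obtain ⟨x, y, hx, hy, h1, h2⟩ := h
  obtain ⟨z, w, hz, hw, h3, h4⟩ := h'
  refine ⟨Matrix.fromBlocks x 0 0 z, Matrix.fromBlocks y 0 0 w, hx.fromBlocks hz,
    hy.fromBlocks hw, ?_, ?_⟩ <;> simp [Matrix.fromBlocks_multiply, h1, h2, h3, h4]

theorem fromBlocks_idem {m n : Type*} [Fintype m] [Fintype n]
    {M : Matrix m m A} {N : Matrix n n A} (hM : M * M = M) (hN : N * N = N) :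
    Matrix.fromBlocks M 0 0 N * Matrix.fromBlocks M 0 0 N = Matrix.fromBlocks M 0 0 N := by
  simp [Matrix.fromBlocks_multiply, hM, hN]

end Matrices

/-- A homogeneous idempotent matrix over a `ℤ`-graded ring, with shifts `shift`.  It represents the
graded finitely generated projective left module that is the image of `⨁ i, A(-shift i)` under
right multiplication by `mat`. -/
structure GrIdem {A : Type*} [NonUnitalRing A] (𝒜 : ℤ → AddSubgroup A) where
  size : ℕ
  shift : Fin size → ℤ
  mat : Matrix (Fin size) (Fin size) A
  homog : IsHomog 𝒜 shift shift mat
  idem : mat * mat = mat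

section Monoid

variable {A : Type*} [NonUnitalRing A] {𝒜 : ℤ → AddSubgroup A}

/-- Block diagonal sum. -/
def GrIdem.add (p q : GrIdem 𝒜) : GrIdem 𝒜 where
  size := p.size + q.size
  shift := Sum.elim p.shift q.shift ∘ finSumFinEquiv.symm
  mat := (Matrix.fromBlocks p.mat 0 0 q.mat).submatrix finSumFinEquiv.symm finSumFinEquiv.symm
  homog := fun _ _ => (p.homog.fromBlocks q.homog) _ _
  idem := by
    rw [← Matrix.submatrix_mul _ _ _ _ _ finSumFinEquiv.symm.bijective,
      fromBlocks_idem p.idem q.idem]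

/-- The empty matrix. -/
def GrIdem.zero : GrIdem 𝒜 where
  size := 0
  shift := Fin.elim0
  mat := 0
  homog := fun i => i.elim0
  idem := by simp

/-- Adding the integer `c` to all shifts; on modules this is `P ↦ P(-c)`. -/
def GrIdem.translate (c : ℤ) (p : GrIdem 𝒜) : GrIdem 𝒜 where
  size := p.size
  shift := fun i => p.shift i + c
  mat := p.mat
  homog := fun i j => by rw [add_sub_add_right_eq_sub]; exact p.homog i j
  idem := p.idem

theorem GrIdem.add_mvn (p q : GrIdem 𝒜) :
    MvN 𝒜 (p.add q).shift (p.add q).mat (Sum.elim p.shift q.shift)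
      (Matrix.fromBlocks p.mat 0 0 q.mat) :=
  MvN.reindex _ (p.homog.fromBlocks q.homog) (fromBlocks_idem p.idem q.idem)

variable (𝒜) in
/-- Two homogeneous idempotent matrices are equivalent if they are `xy` and `yx` for homogeneous
`x`, `y`; that is, if the graded projective modules they represent are graded isomorphic. -/
def grSetoid [SetLike.GradedMul 𝒜] : Setoid (GrIdem 𝒜) where
  r p q := MvN 𝒜 p.shift p.mat q.shift q.mat
  iseqv :=
    { refl := fun p => MvN.refl p.homog p.idem
      symm := fun h => h.symm
      trans := fun {p _ r} h h' => h.trans p.idem r.idem h' }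

variable (𝒜) in
/-- The monoid `𝒱^gr(A)`. -/
def VGr [SetLike.GradedMul 𝒜] : Type _ := Quotient (grSetoid 𝒜)

variable [SetLike.GradedMul 𝒜]

/-- The class of a homogeneous idempotent matrix. -/
def VGr.mk (p : GrIdem 𝒜) : VGr 𝒜 := Quotient.mk (grSetoid 𝒜) p

theorem VGr.mk_eq_mk {p q : GrIdem 𝒜} (h : MvN 𝒜 p.shift p.mat q.shift q.mat) :
    VGr.mk p = VGr.mk q := Quotient.sound h

theorem GrIdem.add_congr {p p' q q' : GrIdem 𝒜}
    (h : MvN 𝒜 p.shift p.mat p'.shift p'.mat) (h' : MvN 𝒜 q.shift q.mat q'.shift q'.mat) :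
    MvN 𝒜 (p.add q).shift (p.add q).mat (p'.add q').shift (p'.add q').mat :=
  ((p.add_mvn q).trans (p.add q).idem (fromBlocks_idem p'.idem q'.idem)
    (h.fromBlocks h')).trans (p.add q).idem (p'.add q').idem (p'.add_mvn q').symm

instance : Add (VGr 𝒜) :=
  ⟨Quotient.map₂ GrIdem.add fun _ _ h _ _ h' => GrIdem.add_congr h h'⟩

instance : Zero (VGr 𝒜) := ⟨VGr.mk GrIdem.zero⟩

theorem VGr.mk_add_mk (p q : GrIdem 𝒜) : VGr.mk p + VGr.mk q = VGr.mk (p.add q) := rfl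

theorem VGr.add_comm' (a b : VGr 𝒜) : a + b = b + a := by
  induction a using Quotient.ind with | _ p
  induction b using Quotient.ind with | _ q
  refine VGr.mk_eq_mk ?_
  have h := MvN.reindex (Equiv.sumComm (Fin q.size) (Fin p.size))
    (p.homog.fromBlocks q.homog) (fromBlocks_idem p.idem q.idem)
  have e1 : Sum.elim p.shift q.shift ∘ (Equiv.sumComm (Fin q.size) (Fin p.size)) =
      Sum.elim q.shift p.shift := by ext (i | i) <;> rfl
  have e2 : (Matrix.fromBlocks p.mat 0 0 q.mat).submatrix
      (Equiv.sumComm (Fin q.size) (Fin p.size)) (Equiv.sumComm (Fin q.size) (Fin p.size)) =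
      Matrix.fromBlocks q.mat 0 0 p.mat := by ext (i | i) (j | j) <;> rfl
  rw [e1, e2] at h
  exact ((p.add_mvn q).trans (p.add q).idem (fromBlocks_idem q.idem p.idem) h.symm).trans
    (p.add q).idem (q.add p).idem (q.add_mvn p).symm

theorem VGr.zero_add' (a : VGr 𝒜) : 0 + a = a := by
  induction a using Quotient.ind with | _ q
  refine VGr.mk_eq_mk ?_
  have h := MvN.reindex (Equiv.emptySum (Fin 0) (Fin q.size)) q.homog q.idem
  have e1 : q.shift ∘ (Equiv.emptySum (Fin 0) (Fin q.size)) =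
      Sum.elim (GrIdem.zero (𝒜 := 𝒜)).shift q.shift := by
    ext (i | i)
    · exact i.elim0
    · rfl
  have e2 : q.mat.submatrix (Equiv.emptySum (Fin 0) (Fin q.size))
      (Equiv.emptySum (Fin 0) (Fin q.size)) =
      Matrix.fromBlocks (GrIdem.zero (𝒜 := 𝒜)).mat 0 0 q.mat := by
    ext (i | i) (j | j)
    · exact i.elim0
    · exact i.elim0
    · exact j.elim0
    · rfl
  rw [e1, e2] at h
  exact (GrIdem.zero.add_mvn q).trans (GrIdem.zero.add q).idem q.idem h

theorem VGr.add_assoc' (a b c : VGr 𝒜) : a + b + c = a + (b + c) := by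
  induction a using Quotient.ind with | _ p
  induction b using Quotient.ind with | _ q
  induction c using Quotient.ind with | _ r
  refine VGr.mk_eq_mk ?_
  have hl : MvN 𝒜 ((p.add q).add r).shift ((p.add q).add r).mat
      (Sum.elim (Sum.elim p.shift q.shift) r.shift)
      (Matrix.fromBlocks (Matrix.fromBlocks p.mat 0 0 q.mat) 0 0 r.mat) :=
    ((p.add q).add_mvn r).trans ((p.add q).add r).idem
      (fromBlocks_idem (fromBlocks_idem p.idem q.idem) r.idem)
      ((p.add_mvn q).fromBlocks (MvN.refl r.homog r.idem))
  have hr : MvN 𝒜 (p.add (q.add r)).shift (p.add (q.add r)).mat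
      (Sum.elim p.shift (Sum.elim q.shift r.shift))
      (Matrix.fromBlocks p.mat 0 0 (Matrix.fromBlocks q.mat 0 0 r.mat)) :=
    (p.add_mvn (q.add r)).trans (p.add (q.add r)).idem
      (fromBlocks_idem p.idem (fromBlocks_idem q.idem r.idem))
      ((MvN.refl p.homog p.idem).fromBlocks (q.add_mvn r))
  have h := MvN.reindex (Equiv.sumAssoc (Fin p.size) (Fin q.size) (Fin r.size))
    (p.homog.fromBlocks (q.homog.fromBlocks r.homog))
    (fromBlocks_idem p.idem (fromBlocks_idem q.idem r.idem))
  have e1 : Sum.elim p.shift (Sum.elim q.shift r.shift) ∘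
      (Equiv.sumAssoc (Fin p.size) (Fin q.size) (Fin r.size)) =
      Sum.elim (Sum.elim p.shift q.shift) r.shift := by ext ((i | i) | i) <;> rfl
  have e2 : (Matrix.fromBlocks p.mat 0 0 (Matrix.fromBlocks q.mat 0 0 r.mat)).submatrix
      (Equiv.sumAssoc (Fin p.size) (Fin q.size) (Fin r.size))
      (Equiv.sumAssoc (Fin p.size) (Fin q.size) (Fin r.size)) =
      Matrix.fromBlocks (Matrix.fromBlocks p.mat 0 0 q.mat) 0 0 r.mat := by
    ext ((i | i) | i) ((j | j) | j) <;> rfl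
  rw [e1, e2] at h
  exact (hl.trans ((p.add q).add r).idem (fromBlocks_idem p.idem (fromBlocks_idem q.idem r.idem))
    h).trans ((p.add q).add r).idem (p.add (q.add r)).idem hr.symm

instance : AddCommMonoid (VGr 𝒜) where
  add_assoc := VGr.add_assoc'
  zero_add := VGr.zero_add'
  add_zero a := by rw [VGr.add_comm', VGr.zero_add']
  add_comm := VGr.add_comm'
  nsmul := nsmulRec

/-- The translation action of `ℤ` on `𝒱^gr(A)`, `[P] ↦ [P(-c)]`. -/
def VGr.translate (c : ℤ) : VGr 𝒜 →+ VGr 𝒜 where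
  toFun := Quotient.map (GrIdem.translate c) fun _ _ ⟨x, y, hx, hy, h1, h2⟩ =>
    ⟨x, y, fun i j => by
      change x i j ∈ 𝒜 (_ + c - (_ + c)); rw [add_sub_add_right_eq_sub]; exact hx i j,
     fun i j => by
      change y i j ∈ 𝒜 (_ + c - (_ + c)); rw [add_sub_add_right_eq_sub]; exact hy i j,
     h1, h2⟩
  map_zero' := by
    refine VGr.mk_eq_mk ⟨0, 0, fun i => i.elim0, fun i => i.elim0, ?_, ?_⟩ <;>
      (ext i; exact i.elim0)
  map_add' a b := by
    induction a using Quotient.ind with | _ p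
    induction b using Quotient.ind with | _ q
    have hs : ((p.add q).translate c).shift = ((p.translate c).add (q.translate c)).shift := by
      funext i
      change Sum.elim p.shift q.shift (finSumFinEquiv.symm i) + c =
        Sum.elim (fun i => p.shift i + c) (fun i => q.shift i + c) (finSumFinEquiv.symm i)
      cases finSumFinEquiv.symm i <;> rfl
    refine VGr.mk_eq_mk (p := (p.add q).translate c)
      (q := (p.translate c).add (q.translate c)) ?_
    rw [← hs]
    exact MvN.refl ((p.add q).translate c).homog ((p.add q).translate c).idem

variable (𝒜) in
/-- The graded Grothendieck group `K₀^gr(A)`, the group completion of `𝒱^gr(A)`. -/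
abbrev K0Gr : Type _ := Algebra.GrothendieckAddGroup (VGr 𝒜)

/-- The translation action of `ℤ` on `K₀^gr(A)`, `[P] ↦ [P(-c)]`. -/
noncomputable def K0Gr.translate (c : ℤ) : K0Gr 𝒜 →+ K0Gr 𝒜 :=
  Algebra.GrothendieckAddGroup.lift (Algebra.GrothendieckAddGroup.of.comp (VGr.translate c))

variable (𝒜) in
/-- The class `[A u (-i)]` in `K₀^gr(A)`, for an idempotent `u` of degree `0`. -/
noncomputable def K0Gr.ofIdem (u : A) (h0 : u ∈ 𝒜 0) (hu : u * u = u) (i : ℤ) : K0Gr 𝒜 :=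
  Algebra.GrothendieckAddGroup.of (VGr.mk
    { size := 1
      shift := fun _ => i
      mat := Matrix.of fun _ _ => u
      homog := fun _ _ => by simpa using h0
      idem := by ext i j; simp [Matrix.mul_apply, hu] })

end Monoid

end GradedK

/-! ### Directed graphs and their Leavitt path algebras -/

/-- A directed graph with vertex set `V` and edge set `D`. -/
structure DirGraph (V D : Type*) where
  s : D → V
  r : D → V

namespace DirGraph

variable {V D : Type*} (E : DirGraph V D)

/-- Every vertex emits finitely many edges. -/
def RowFinite : Prop := ∀ v, {e | E.s e = v}.Finite

/-- A sink emits no edge. -/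
def IsSink (v : V) : Prop := ∀ e, E.s e ≠ v

/-- The regular vertices (non-sinks, for row-finite graphs). -/
abbrev R : Type _ := {v : V // ¬ E.IsSink v}

/-- The sinks. -/
abbrev S : Type _ := {v : V // E.IsSink v}

/-- The generators: vertices, edges `e`, and ghost edges `e*`. -/
inductive Gen (V D : Type*) where
  | vertex (v : V)
  | edge (e : D)
  | ghost (e : D)

section LPA

variable (k : Type*) [Field k]

/-- The free (non-unital) associative `k`-algebra on the generators. -/
abbrev FreeAlg (V D : Type*) : Type _ := MonoidAlgebra k (FreeSemigroup (Gen V D))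

/-- A generator as an element of the free algebra. -/
noncomputable def gen {V D : Type*} (g : Gen V D) : FreeAlg k V D :=
  MonoidAlgebra.single (FreeSemigroup.of g) 1

open Gen in
/-- The elements of the free algebra that have to vanish in the Leavitt path algebra. -/
inductive Relator : FreeAlg k V D → Prop
  | vertex_mul_self (v : V) : Relator (gen k (vertex v) * gen k (vertex v) - gen k (vertex v))
  | vertex_mul_of_ne (v w : V) (h : v ≠ w) : Relator (gen k (vertex v) * gen k (vertex w))
  | source_mul_edge (e : D) : Relator (gen k (vertex (E.s e)) * gen k (edge e) - gen k (edge e))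
  | edge_mul_range (e : D) : Relator (gen k (edge e) * gen k (vertex (E.r e)) - gen k (edge e))
  | range_mul_ghost (e : D) :
      Relator (gen k (vertex (E.r e)) * gen k (ghost e) - gen k (ghost e))
  | ghost_mul_source (e : D) :
      Relator (gen k (ghost e) * gen k (vertex (E.s e)) - gen k (ghost e))
  | ghost_mul_self (e : D) :
      Relator (gen k (ghost e) * gen k (edge e) - gen k (vertex (E.r e)))
  | ghost_mul_of_ne (e f : D) (h : e ≠ f) : Relator (gen k (ghost e) * gen k (edge f))
  | vertex_eq_sum (v : V) (hv : ¬ E.IsSink v) (hfin : {e | E.s e = v}.Finite) :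
      Relator (gen k (vertex v) - ∑ e ∈ hfin.toFinset, gen k (edge e) * gen k (ghost e))

/-- The two-sided algebra ideal generated by the relators (the `k`-multiples are needed because
the free algebra has no unit). -/
noncomputable def leavittIdeal : TwoSidedIdeal (FreeAlg k V D) :=
  TwoSidedIdeal.span {x | ∃ (c : k) (y : FreeAlg k V D), E.Relator k y ∧ c • y = x}

/-- The Leavitt path algebra `L_k(E)`, as a (non-unital) ring. -/
def LPA : Type _ := (E.leavittIdeal k).ringCon.Quotient

noncomputable instance : NonUnitalRing (E.LPA k) :=
  inferInstanceAs (NonUnitalRing (E.leavittIdeal k).ringCon.Quotient)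

/-- The quotient map from the free algebra. -/
noncomputable def LPA.mk : FreeAlg k V D →ₙ+* E.LPA k where
  toFun := fun x => RingCon.toQuotient x
  map_mul' _ _ := rfl
  map_zero' := rfl
  map_add' _ _ := rfl

theorem LPA.mk_eq_mk_iff {x y : FreeAlg k V D} :
    LPA.mk E k x = LPA.mk E k y ↔ x - y ∈ E.leavittIdeal k := by
  rw [← TwoSidedIdeal.rel_iff]
  exact RingCon.eq _

theorem leavittIdeal_smul_mem (c : k) {x : FreeAlg k V D} (hx : x ∈ E.leavittIdeal k) :
    c • x ∈ E.leavittIdeal k := by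
  unfold leavittIdeal at *
  induction hx using TwoSidedIdeal.span_induction with
  | mem x h =>
    obtain ⟨d, y, hy, rfl⟩ := h
    exact TwoSidedIdeal.subset_span ⟨c * d, y, hy, (smul_smul c d y).symm⟩
  | zero => rw [smul_zero]; exact zero_mem _
  | add x y _ _ hx hy => rw [smul_add]; exact add_mem hx hy
  | neg x _ hx => rw [smul_neg]; exact neg_mem hx
  | left_absorb a x _ hx => rw [← mul_smul_comm]; exact TwoSidedIdeal.mul_mem_left _ _ _ hx
  | right_absorb b x _ hx => rw [← smul_mul_assoc]; exact TwoSidedIdeal.mul_mem_right _ _ _ hx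

/-- The `k`-algebra structure of `L_k(E)`. -/
noncomputable instance : SMul k (E.LPA k) where
  smul c := Quotient.map' (c • ·) fun x y h => by
    have h' := E.leavittIdeal_smul_mem k c ((TwoSidedIdeal.rel_iff _ x y).1 h)
    rw [smul_sub] at h'
    exact (TwoSidedIdeal.rel_iff _ _ _).2 h'

theorem LPA.mk_surjective : Function.Surjective (LPA.mk E k) := Quotient.mk''_surjective

theorem LPA.mk_smul (c : k) (x : FreeAlg k V D) : LPA.mk E k (c • x) = c • LPA.mk E k x := rfl

noncomputable instance : Module k (E.LPA k) :=
  Function.Surjective.module k (LPA.mk E k).toAddMonoidHom (LPA.mk_surjective E k)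
    (LPA.mk_smul E k)

instance : IsScalarTower k (E.LPA k) (E.LPA k) where
  smul_assoc c a b := by
    obtain ⟨x, rfl⟩ := LPA.mk_surjective E k a
    obtain ⟨y, rfl⟩ := LPA.mk_surjective E k b
    simp only [smul_eq_mul, ← LPA.mk_smul, ← map_mul, smul_mul_assoc]

instance : SMulCommClass k (E.LPA k) (E.LPA k) where
  smul_comm c a b := by
    obtain ⟨x, rfl⟩ := LPA.mk_surjective E k a
    obtain ⟨y, rfl⟩ := LPA.mk_surjective E k b
    simp only [smul_eq_mul, ← LPA.mk_smul, ← map_mul, mul_smul_comm]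

/-- The degree of a generator: `0` for vertices, `1` for edges, `-1` for ghost edges. -/
def Gen.degree : Gen V D → ℤ
  | .vertex _ => 0
  | .edge _ => 1
  | .ghost _ => -1

/-- The degree of a word in the generators. -/
def wordDegree (w : FreeSemigroup (Gen V D)) : ℤ :=
  Multiplicative.toAdd (FreeSemigroup.lift (fun g => Multiplicative.ofAdd g.degree) w)

/-- The homogeneous component of degree `n`: all sums of `k`-multiples of words of degree `n`. -/
noncomputable def LPA.component (n : ℤ) : AddSubgroup (E.LPA k) :=
  AddSubgroup.closure
    {a | ∃ (c : k) (w : FreeSemigroup (Gen V D)), wordDegree w = n ∧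
      LPA.mk E k (MonoidAlgebra.single w c) = a}

instance : SetLike.GradedMul (LPA.component E k) where
  mul_mem i j a b ha hb := by
    induction ha using AddSubgroup.closure_induction with
    | zero => rw [zero_mul]; exact zero_mem _
    | add x y _ _ hx hy => rw [add_mul]; exact add_mem hx hy
    | neg x _ hx => rw [neg_mul]; exact neg_mem hx
    | mem x hx =>
      induction hb using AddSubgroup.closure_induction with
      | zero => rw [mul_zero]; exact zero_mem _
      | add x y _ _ hx hy => rw [mul_add]; exact add_mem hx hy
      | neg x _ hx => rw [mul_neg]; exact neg_mem hx
      | mem y hy =>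
        obtain ⟨c, w, rfl, rfl⟩ := hx
        obtain ⟨d, u, rfl, rfl⟩ := hy
        refine AddSubgroup.subset_closure ⟨c * d, w * u, ?_, ?_⟩
        · simp [wordDegree]
        · rw [← map_mul, MonoidAlgebra.single_mul_single]

/-- The vertex `v` as an element of `L_k(E)`. -/
noncomputable def LPA.vertex (v : V) : E.LPA k := LPA.mk E k (gen k (Gen.vertex v))

theorem LPA.vertex_mem (v : V) : LPA.vertex E k v ∈ LPA.component E k 0 :=
  AddSubgroup.subset_closure ⟨1, FreeSemigroup.of (Gen.vertex v), rfl, rfl⟩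

theorem LPA.vertex_idem (v : V) : LPA.vertex E k v * LPA.vertex E k v = LPA.vertex E k v := by
  rw [LPA.vertex, ← map_mul, LPA.mk_eq_mk_iff]
  exact TwoSidedIdeal.subset_span ⟨1, _, Relator.vertex_mul_self v, one_smul _ _⟩

/-- The graded Grothendieck group of `L_k(E)`. -/
abbrev K0GrLPA : Type _ := GradedK.K0Gr (LPA.component E k)

/-- The element `v(i) = [(L(E)v)(-i)]` of `K₀^gr(L(E))`. -/
noncomputable def vertexClass (v : V) (i : ℤ) : E.K0GrLPA k :=
  GradedK.K0Gr.ofIdem (LPA.component E k) (LPA.vertex E k v) (LPA.vertex_mem E k v)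
    (LPA.vertex_idem E k v) i

/-- `φ : K₀^gr(L(E)) → K₀^gr(L(E))`, `[P] ↦ [P(-1)] - [P]`, so that `v(i) ↦ v(i+1) - v(i)`. -/
noncomputable def phi : E.K0GrLPA k →+ E.K0GrLPA k :=
  GradedK.K0Gr.translate 1 - AddMonoidHom.id _

end LPA

/-! ### The maps `K` and `ψ` -/

/-- The adjacency matrix `A_E`: the number of edges from `v` to `w`. -/
noncomputable def adj : Matrix V V ℤ := fun v w => (Nat.card {e : D // E.s e = v ∧ E.r e = w} : ℤ)

/-- The block of `A_E` with rows and columns in `R`. -/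
noncomputable def B : Matrix E.R E.R ℤ := E.adj.submatrix Subtype.val Subtype.val

/-- The block of `A_E` with rows in `R` and columns in `S`. -/
noncomputable def C : Matrix E.R E.S ℤ := E.adj.submatrix Subtype.val Subtype.val

/-- The homomorphism `ℤ^m → ℤ^n`, `x ↦ Mᵗ x`, on direct sums, for an integral matrix `M` with
finitely supported rows: `(Mᵗ x)_j = ∑ i, x_i * M i j`. -/
noncomputable def transposeHom {m n : Type*} (M : Matrix m n ℤ)
    (hM : ∀ i, (Function.support (M i)).Finite) : (m →₀ ℤ) →+ (n →₀ ℤ) :=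
  Finsupp.liftAddHom fun i =>
    (zmultiplesHom _) (Finsupp.ofSupportFinite (M i) (hM i))

variable {E}

theorem RowFinite.adj_support (hE : E.RowFinite) (v : V) :
    (Function.support (E.adj v)).Finite := by
  refine ((hE v).image E.r).subset fun w hw => ?_
  have h : Nat.card {e : D // E.s e = v ∧ E.r e = w} ≠ 0 := fun h => hw (by simp [adj, h])
  obtain ⟨⟨e, he⟩⟩ := (Nat.card_ne_zero.1 h).1
  exact ⟨e, he.1, he.2⟩

theorem RowFinite.B_support (hE : E.RowFinite) (v : E.R) : (Function.support (E.B v)).Finite :=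
  Set.Finite.preimage Subtype.val_injective.injOn (hE.adj_support v.1)

theorem RowFinite.C_support (hE : E.RowFinite) (v : E.R) : (Function.support (E.C v)).Finite :=
  Set.Finite.preimage Subtype.val_injective.injOn (hE.adj_support v.1)

/-- `K(x) = ((Bᵗ - I) x, Cᵗ x)`. -/
noncomputable def mapK (hE : E.RowFinite) : (E.R →₀ ℤ) →+ (E.R →₀ ℤ) × (E.S →₀ ℤ) :=
  (transposeHom E.B hE.B_support - AddMonoidHom.id _).prod (transposeHom E.C hE.C_support)

variable (E) in
/-- `ψ(y) = y(0) = ∑ v, y_v v(0)`. -/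
noncomputable def psi (k : Type*) [Field k] : (E.R →₀ ℤ) × (E.S →₀ ℤ) →+ E.K0GrLPA k :=
  AddMonoidHom.coprod
    (Finsupp.liftAddHom fun v => (zmultiplesHom _) (E.vertexClass k v.1 0))
    (Finsupp.liftAddHom fun v => (zmultiplesHom _) (E.vertexClass k v.1 0))

end DirGraph

/-! Write `U = ℤ^R` and `W = ℤ^R ⊕ ℤ^S`, let `j : U → W` be the inclusion and `a : U → W` the map `x
↦ (Bᵗx, Cᵗx)`. The heart of the matter is a presentation: `K₀^gr(L(E))` is the cokernel of the
injective map `t·j - a : U[t,t⁻¹] → W[t,t⁻¹]`, where `t^i` marks the shift `i`, and `φ` is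
multiplication by `t - 1`. On Laurent polynomials `t - 1` is injective with cokernel given by
setting `t = 1`, so the snake lemma yields an exact sequence `0 → Ker φ → U → W → Coker φ → 0` with
middle map `j - a = -K`. This is carried out by hand in `eq_zero_of_zero_component`,
`exists_zero_component`, `exists_zero_component_add` and `exists_of_zero_component_mem_range`, which
also show that the isomorphisms are the ones given by `ψ`.

For the presentation, the relations `v(i+1) = ∑ r(e)(i)` over the edges `e` leaving `v` come from
the row of edges and the column of ghost edges (`vertexVGr_succ`). That nothing else is needed rests
on boundary paths: the paths of length `n` from `v`, together with the shorter ones ending in a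
sink, satisfy `p* q = 0` for `p ≠ q`, `p* p = r(p)` and `∑ p p* = v`. Compressing a homogeneous
matrix by sufficiently long boundary paths leaves only scalar multiples of vertices
(`eventually_exists_scalarMat`), and the scalars vanish between different shifted vertices. Vertices
are nonzero (`vertex_ne_zero`), so these scalars are well defined and linear algebra over `k`
applies one shifted vertex at a time. An idempotent splits, so vertices generate
(`exists_mvn_diagV`); an invertible matrix has square blocks, so two equivalent families of vertices
agree after refinement (`sum_eq_of_mvn`). The universal property `exists_hom` and then the exactness
statement `exists_shiftSub_eq` follow. -/

namespace DirGraph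

variable {V D : Type*} (E : DirGraph V D) (k : Type*) [Field k]

/-! ### Relations, words and local units in the Leavitt path algebra. -/

/-- An edge as an element of `L_k(E)`. -/
noncomputable def LPA.edge (e : D) : E.LPA k := LPA.mk E k (gen k (Gen.edge e))

/-- A ghost edge as an element of `L_k(E)`. -/
noncomputable def LPA.ghost (e : D) : E.LPA k := LPA.mk E k (gen k (Gen.ghost e))

variable {E k}

theorem Relator.mk_eq_zero {x : FreeAlg k V D} (h : E.Relator k x) : LPA.mk E k x = 0 := by
  rw [← map_zero (LPA.mk E k), LPA.mk_eq_mk_iff, sub_zero]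
  exact TwoSidedIdeal.subset_span ⟨1, _, h, one_smul _ _⟩

variable (E k)

namespace LPA

theorem vertex_mul_of_ne {v w : V} (h : v ≠ w) : vertex E k v * vertex E k w = 0 := by
  simpa [vertex] using (Relator.vertex_mul_of_ne (E := E) (k := k) v w h).mk_eq_zero

theorem source_mul_edge (e : D) : vertex E k (E.s e) * edge E k e = edge E k e := by
  simpa [vertex, edge, sub_eq_zero] using
    (Relator.source_mul_edge (E := E) (k := k) e).mk_eq_zero

theorem edge_mul_range (e : D) : edge E k e * vertex E k (E.r e) = edge E k e := by
  simpa [vertex, edge, sub_eq_zero] using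
    (Relator.edge_mul_range (E := E) (k := k) e).mk_eq_zero

theorem range_mul_ghost (e : D) : vertex E k (E.r e) * ghost E k e = ghost E k e := by
  simpa [vertex, ghost, sub_eq_zero] using
    (Relator.range_mul_ghost (E := E) (k := k) e).mk_eq_zero

theorem ghost_mul_source (e : D) : ghost E k e * vertex E k (E.s e) = ghost E k e := by
  simpa [vertex, ghost, sub_eq_zero] using
    (Relator.ghost_mul_source (E := E) (k := k) e).mk_eq_zero

theorem ghost_mul_self (e : D) : ghost E k e * edge E k e = vertex E k (E.r e) := by
  simpa [vertex, edge, ghost, sub_eq_zero] using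
    (Relator.ghost_mul_self (E := E) (k := k) e).mk_eq_zero

theorem ghost_mul_of_ne {e f : D} (h : e ≠ f) : ghost E k e * edge E k f = 0 := by
  simpa [edge, ghost] using (Relator.ghost_mul_of_ne (E := E) (k := k) e f h).mk_eq_zero

theorem sum_edge_mul_ghost {v : V} (hv : ¬ E.IsSink v) [Fintype {e : D // E.s e = v}] :
    ∑ e : {e : D // E.s e = v}, edge E k e.1 * ghost E k e.1 = vertex E k v := by
  have hfin : {e | E.s e = v}.Finite :=
    Set.finite_coe_iff.1 (Finite.of_fintype {e : D // E.s e = v})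
  have h := (Relator.vertex_eq_sum (E := E) (k := k) v hv hfin).mk_eq_zero
  rw [map_sub, sub_eq_zero, map_sum] at h
  simp only [map_mul] at h
  change vertex E k v = ∑ e ∈ _, edge E k e * ghost E k e at h
  rw [h]
  exact (Finset.sum_subtype hfin.toFinset (fun e => by simp)
    (fun e => edge E k e * ghost E k e)).symm

theorem edge_mem (e : D) : edge E k e ∈ component E k 1 :=
  AddSubgroup.subset_closure ⟨1, FreeSemigroup.of (Gen.edge e), rfl, rfl⟩

theorem ghost_mem (e : D) : ghost E k e ∈ component E k (-1) :=
  AddSubgroup.subset_closure ⟨1, FreeSemigroup.of (Gen.ghost e), rfl, rfl⟩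

variable {E k} in
theorem smul_mem_component {n : ℤ} (c : k) {x : E.LPA k} (hx : x ∈ component E k n) :
    c • x ∈ component E k n := by
  induction hx using AddSubgroup.closure_induction with
  | zero => rw [smul_zero]; exact zero_mem _
  | add x y _ _ hx hy => rw [smul_add]; exact add_mem hx hy
  | neg x _ hx => rw [smul_neg]; exact neg_mem hx
  | mem x hx =>
    obtain ⟨d, w, hw, rfl⟩ := hx
    refine AddSubgroup.subset_closure ⟨c * d, w, hw, ?_⟩
    rw [← mk_smul, MonoidAlgebra.smul_single, smul_eq_mul]

/-- A generator as an element of `L_k(E)`. -/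
noncomputable def ofGen (g : Gen V D) : E.LPA k := mk E k (gen k g)

/-- The product in `L_k(E)` of a list of generators and an element. -/
noncomputable def listMul (l : List (Gen V D)) (y : E.LPA k) : E.LPA k :=
  l.foldr (fun g z => ofGen E k g * z) y

variable {E k}

/-- Turns a word into successive left multiplications, so that letters can be consumed one at a time
from the left. -/
theorem mk_single_mul (w : FreeSemigroup (Gen V D)) (c : k) (y : E.LPA k) :
    mk E k (MonoidAlgebra.single w c) * y = c • listMul E k (w.head :: w.tail) y := by
  induction w using FreeSemigroup.recOnMul generalizing c y with
  | ih1 g =>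
    have : MonoidAlgebra.single (FreeSemigroup.of g) c = c • (gen k g : FreeAlg k V D) := by
      rw [gen, MonoidAlgebra.smul_single, smul_eq_mul, mul_one]
    rw [this, mk_smul, smul_mul_assoc]
    rfl
  | ih2 g w _ ih =>
    have : MonoidAlgebra.single (FreeSemigroup.of g * w) c =
        (gen k g : FreeAlg k V D) * MonoidAlgebra.single w c := by
      rw [gen, MonoidAlgebra.single_mul_single, one_mul]
    rw [this, map_mul, mul_assoc, ih, mul_smul_comm]
    rfl

theorem wordDegree_eq (w : FreeSemigroup (Gen V D)) :
    wordDegree w = ((w.head :: w.tail).map Gen.degree).sum := by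
  induction w using FreeSemigroup.recOnMul with
  | ih1 g => exact (add_zero g.degree).symm
  | ih2 g w _ ih =>
    have : wordDegree (FreeSemigroup.of g * w) = g.degree + wordDegree w := by
      simp [wordDegree]
    rw [this, ih]
    simp [FreeSemigroup.of]

/-- Every element has a local unit that is a sum of distinct vertices, on the left. -/
theorem exists_localUnit (x : E.LPA k) : ∃ X : Finset V, ∀ Y, X ⊆ Y →
    (∑ v ∈ Y, vertex E k v) * x = x ∧ x * (∑ v ∈ Y, vertex E k v) = x := by
  classical
  have hgen : ∀ g : Gen V D, ∃ X : Finset V, ∀ Y, X ⊆ Y →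
      (∑ v ∈ Y, vertex E k v) * ofGen E k g = ofGen E k g ∧
        ofGen E k g * (∑ v ∈ Y, vertex E k v) = ofGen E k g := by
    intro g
    have key : ∀ (a b : V) (x : E.LPA k), vertex E k a * x = x → x * vertex E k b = x →
        ∃ X : Finset V, ∀ Y, X ⊆ Y →
          (∑ v ∈ Y, vertex E k v) * x = x ∧ x * (∑ v ∈ Y, vertex E k v) = x := by
      intro a b x ha hb
      refine ⟨{a, b}, fun Y hY => ⟨?_, ?_⟩⟩
      · rw [Finset.sum_mul, Finset.sum_eq_single a, ha]
        · intro v _ hv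
          rw [← ha, ← mul_assoc, vertex_mul_of_ne E k hv, zero_mul]
        · intro h
          exact absurd (hY (by simp)) h
      · rw [Finset.mul_sum, Finset.sum_eq_single b, hb]
        · intro v _ hv
          rw [← hb, mul_assoc, vertex_mul_of_ne E k hv.symm, mul_zero]
        · intro h
          exact absurd (hY (by simp)) h
    cases g with
    | vertex v => exact key v v _ (vertex_idem E k v) (vertex_idem E k v)
    | edge e => exact key _ _ _ (source_mul_edge E k e) (edge_mul_range E k e)
    | ghost e => exact key _ _ _ (range_mul_ghost E k e) (ghost_mul_source E k e)
  have hmul : ∀ x y : E.LPA k,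
      (∃ X : Finset V, ∀ Y, X ⊆ Y →
        (∑ v ∈ Y, vertex E k v) * x = x ∧ x * (∑ v ∈ Y, vertex E k v) = x) →
      (∃ X : Finset V, ∀ Y, X ⊆ Y →
        (∑ v ∈ Y, vertex E k v) * y = y ∧ y * (∑ v ∈ Y, vertex E k v) = y) →
      ∃ X : Finset V, ∀ Y, X ⊆ Y →
        (∑ v ∈ Y, vertex E k v) * (x * y) = x * y ∧
          x * y * (∑ v ∈ Y, vertex E k v) = x * y := by
    rintro x y ⟨X, hX⟩ ⟨X', hX'⟩
    refine ⟨X ∪ X', fun Y hY => ⟨?_, ?_⟩⟩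
    · rw [← mul_assoc, (hX Y (Finset.union_subset_left hY)).1]
    · rw [mul_assoc, (hX' Y (Finset.union_subset_right hY)).2]
  obtain ⟨x, rfl⟩ := mk_surjective E k x
  induction x using MonoidAlgebra.induction_linear with
  | zero => exact ⟨∅, fun Y _ => by simp⟩
  | add x y hx hy =>
    obtain ⟨X, hX⟩ := hx
    obtain ⟨X', hX'⟩ := hy
    refine ⟨X ∪ X', fun Y hY => ?_⟩
    have h := hX Y (Finset.union_subset_left hY)
    have h' := hX' Y (Finset.union_subset_right hY)
    rw [map_add, mul_add, add_mul, h.1, h.2, h'.1, h'.2]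
    exact ⟨rfl, rfl⟩
  | single w c =>
    induction w using FreeSemigroup.recOnMul generalizing c with
    | ih1 g =>
      obtain ⟨X, hX⟩ := hgen g
      refine ⟨X, fun Y hY => ?_⟩
      have : MonoidAlgebra.single (FreeSemigroup.of g) c = c • (gen k g : FreeAlg k V D) := by
        rw [gen, MonoidAlgebra.smul_single, smul_eq_mul, mul_one]
      have h := hX Y hY
      rw [ofGen] at h
      rw [this, mk_smul, smul_mul_assoc, mul_smul_comm, h.1, h.2]
      exact ⟨rfl, rfl⟩
    | ih2 g w _ ih =>
      have : MonoidAlgebra.single (FreeSemigroup.of g * w) c =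
          (gen k g : FreeAlg k V D) * MonoidAlgebra.single w c := by
        rw [gen, MonoidAlgebra.single_mul_single, one_mul]
      rw [this, map_mul]
      exact hmul _ _ (hgen g) (ih c)

end LPA

/-! ### Vertices do not vanish -/

variable {E}

/-- For a regular `v`, finitely many (and at least one) copies of `ℕ`, one per edge leaving `v`, are
again in bijection with `ℕ`. This decomposes the basis at `v` into the images of its edges, as the
vertex relation demands of a representation. -/
theorem RowFinite.exists_branching (hE : E.RowFinite) : ∃ θ : D → ℕ → ℕ,
    (∀ e e' n n', E.s e = E.s e' → θ e n = θ e' n' → e = e' ∧ n = n') ∧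
      ∀ v, ¬ E.IsSink v → ∀ m, ∃ e n, E.s e = v ∧ θ e n = m := by
  have h : ∀ v, ∃ f : {e : D // E.s e = v} × ℕ → ℕ,
      Function.Injective f ∧ (¬ E.IsSink v → Function.Surjective f) := by
    intro v
    have := (hE v).to_subtype
    change Finite {e : D // E.s e = v} at this
    by_cases hv : E.IsSink v
    · have : IsEmpty {e : D // E.s e = v} := ⟨fun e => hv e.1 e.2⟩
      exact ⟨fun x => isEmptyElim x.1, fun x => isEmptyElim x.1, fun h => absurd hv h⟩
    · obtain ⟨e, he⟩ := not_forall_not.1 hv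
      have : Nonempty {e : D // E.s e = v} := ⟨e, he⟩
      obtain ⟨f⟩ := nonempty_equiv_of_countable (α := {e : D // E.s e = v} × ℕ) (β := ℕ)
      exact ⟨f, f.injective, fun _ => f.surjective⟩
  choose f hf hs using h
  refine ⟨fun e n => f (E.s e) (⟨e, rfl⟩, n), ?_, ?_⟩
  · intro e e' n n' hs h
    have key : ∀ v (h : E.s e = v) (h' : E.s e' = v),
        f v (⟨e, h⟩, n) = f v (⟨e', h'⟩, n') → e = e' ∧ n = n' := by
      intro v h h' heq
      have := hf v heq
      simpa using this
    refine key _ hs rfl ?_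
    have cast : ∀ v (h : E.s e = v), f v (⟨e, h⟩, n) = f (E.s e) (⟨e, rfl⟩, n) := by
      rintro v rfl
      rfl
    exact (cast _ hs).trans h
  · intro v hv m
    obtain ⟨⟨⟨e, rfl⟩, n⟩, h⟩ := hs v hv m
    exact ⟨e, n, rfl, h⟩

section Representation

variable (E)

open Classical in
/-- The action of the generators on the vector space with basis `V × ℕ` that is determined by a
branching. -/
noncomputable def branchingGen (θ : D → ℕ → ℕ) : Gen V D → Module.End k (V × ℕ →₀ k)
  | .vertex v => Finsupp.lift _ k _ fun x => if x.1 = v then Finsupp.single x 1 else 0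
  | .edge e => Finsupp.lift _ k _ fun x =>
      if x.1 = E.r e then Finsupp.single (E.s e, θ e x.2) 1 else 0
  | .ghost e => Finsupp.lift _ k _ fun x =>
      if h : ∃ n, x = (E.s e, θ e n) then Finsupp.single (E.r e, h.choose) 1 else 0

variable {θ : D → ℕ → ℕ}

theorem branchingGen_vertex (v w : V) (n : ℕ) [Decidable (w = v)] :
    branchingGen E k θ (.vertex v) (Finsupp.single (w, n) 1) =
      if w = v then Finsupp.single (w, n) 1 else 0 := by
  simp [branchingGen]

theorem branchingGen_edge (e : D) (w : V) (n : ℕ) [Decidable (w = E.r e)] :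
    branchingGen E k θ (.edge e) (Finsupp.single (w, n) 1) =
      if w = E.r e then Finsupp.single (E.s e, θ e n) 1 else 0 := by
  simp [branchingGen]

theorem branchingGen_ghost
    (hθ : ∀ e e' n n', E.s e = E.s e' → θ e n = θ e' n' → e = e' ∧ n = n')
    (e f : D) (v : V) (n : ℕ) (hv : E.s f = v) [Decidable (e = f)] :
    branchingGen E k θ (.ghost e) (Finsupp.single (v, θ f n) 1) =
      if e = f then Finsupp.single (E.r e, n) 1 else 0 := by
  subst hv
  simp only [branchingGen, Finsupp.lift_apply, zero_smul, Finsupp.sum_single_index, one_smul]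
  split_ifs with h1 h2 h2
  · subst h2
    have := h1.choose_spec
    rw [Prod.mk.injEq] at this
    rw [← (hθ _ _ _ _ rfl this.2).2]
  · have := h1.choose_spec
    rw [Prod.mk.injEq] at this
    exact absurd (hθ _ _ _ _ this.1 this.2).1.symm h2
  · exact absurd ⟨n, by rw [h2]⟩ h1
  · rfl

theorem branchingGen_ghost_of_ne (e : D) (v : V) (m : ℕ) (hv : v ≠ E.s e) :
    branchingGen E k θ (.ghost e) (Finsupp.single (v, m) 1) = 0 := by
  simp only [branchingGen, Finsupp.lift_apply, zero_smul, Finsupp.sum_single_index, one_smul]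
  rw [dif_neg]
  rintro ⟨n, h⟩
  exact hv (Prod.mk.inj h).1

/-- The representation of the free algebra that is determined by a branching. -/
noncomputable def branchingRep (θ : D → ℕ → ℕ) :
    FreeAlg k V D →ₙₐ[k] Module.End k (V × ℕ →₀ k) :=
  MonoidAlgebra.liftMagma k (FreeSemigroup.lift (branchingGen E k θ))

theorem branchingRep_gen (g : Gen V D) : branchingRep E k θ (gen k g) = branchingGen E k θ g := by
  simp [branchingRep, gen]

variable {E}

/-- All relations can be tested on basis vectors: injectivity of the branching gives the relations
`e* f = δ r(e)`, and surjectivity gives the expansion of a regular vertex. -/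
theorem branchingRep_relator (hs : ∀ v, ¬ E.IsSink v → ∀ m, ∃ e n, E.s e = v ∧ θ e n = m)
    (hθ : ∀ e e' n n', E.s e = E.s e' → θ e n = θ e' n' → e = e' ∧ n = n')
    {x : FreeAlg k V D} (hx : E.Relator k x) : branchingRep E k θ x = 0 := by
  classical
  -- A basis vector lies in the image of `e` or is killed by `e*`. The source of `e` is not a sink,
  -- so surjectivity of the branching is available there.
  have ghost_cases : ∀ (e : D) (w : V) (m : ℕ), (∃ n, w = E.s e ∧ m = θ e n) ∨
      branchingGen E k θ (.ghost e) (Finsupp.single (w, m) 1) = 0 := by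
    intro e w m
    by_cases hw : w = E.s e
    · obtain ⟨f, n, hf, rfl⟩ := hs w (fun h => h e hw.symm) m
      by_cases hef : e = f
      · subst hef
        exact Or.inl ⟨n, hw, rfl⟩
      · right
        rw [branchingGen_ghost E k hθ e f w n hf, if_neg hef]
    · exact Or.inr (branchingGen_ghost_of_ne E k e w m hw)
  cases hx with
  | vertex_mul_self v =>
    ext1 ⟨w, n⟩; ext1
    by_cases h : w = v <;> simp [branchingRep_gen, branchingGen_vertex, h]
  | vertex_mul_of_ne v v' h =>
    ext1 ⟨w, n⟩; ext1
    by_cases h' : w = v'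
    · subst h'; simp [branchingRep_gen, branchingGen_vertex, h.symm]
    · simp [branchingRep_gen, branchingGen_vertex, h']
  | source_mul_edge e =>
    ext1 ⟨w, n⟩; ext1
    by_cases h : w = E.r e <;> simp [branchingRep_gen, branchingGen_vertex, branchingGen_edge, h]
  | edge_mul_range e =>
    ext1 ⟨w, n⟩; ext1
    by_cases h : w = E.r e <;> simp [branchingRep_gen, branchingGen_vertex, branchingGen_edge, h]
  | range_mul_ghost e =>
    ext1 ⟨w, m⟩; ext1
    rcases ghost_cases e w m with ⟨n, rfl, rfl⟩ | h
    · simp [branchingRep_gen, branchingGen_ghost E k hθ, branchingGen_vertex]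
    · simp [branchingRep_gen, h]
  | ghost_mul_source e =>
    ext1 ⟨w, m⟩; ext1
    by_cases h : w = E.s e
    · simp [branchingRep_gen, branchingGen_vertex, h]
    · simp [branchingRep_gen, branchingGen_vertex, h, branchingGen_ghost_of_ne]
  | ghost_mul_self e =>
    ext1 ⟨w, n⟩; ext1
    by_cases h : w = E.r e <;>
      simp [branchingRep_gen, branchingGen_vertex, branchingGen_edge,
        branchingGen_ghost E k hθ, h]
  | ghost_mul_of_ne e f hef =>
    ext1 ⟨w, n⟩; ext1
    by_cases h : w = E.r f
    · simp [branchingRep_gen, branchingGen_edge, branchingGen_ghost E k hθ, h, hef]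
    · simp [branchingRep_gen, branchingGen_edge, h]
  | vertex_eq_sum v hv hfin =>
    ext1 ⟨w, m⟩; ext1
    by_cases h : w = v
    · subst h
      obtain ⟨e, n, he, rfl⟩ := hs w hv m
      have : ∀ f, branchingGen E k θ (.edge f)
          (branchingGen E k θ (.ghost f) (Finsupp.single (w, θ e n) 1)) =
            if f = e then Finsupp.single (w, θ e n) 1 else 0 := by
        intro f
        by_cases hf : f = e
        · subst hf
          simp [branchingGen_ghost E k hθ _ _ _ _ he, branchingGen_edge, he]
        · simp [branchingGen_ghost E k hθ _ _ _ _ he, hf]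
      simp [branchingRep_gen, branchingGen_vertex, LinearMap.sum_apply, this, he]
    · have : ∀ f ∈ hfin.toFinset, branchingGen E k θ (.edge f)
          (branchingGen E k θ (.ghost f) (Finsupp.single (w, m) 1)) = 0 := by
        intro f hf
        rw [branchingGen_ghost_of_ne E k f w m, map_zero]
        rw [Set.Finite.mem_toFinset] at hf
        rwa [show E.s f = v from hf]
      simp [branchingRep_gen, branchingGen_vertex, LinearMap.sum_apply, h,
        Finset.sum_eq_zero this]

end Representation

/-- The branching representation kills the defining ideal, while `v` fixes the basis vector `(v,
0)`. -/
theorem RowFinite.vertex_ne_zero (hE : E.RowFinite) (v : V) : LPA.vertex E k v ≠ 0 := by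
  classical
  obtain ⟨θ, hθ, hs⟩ := hE.exists_branching
  intro h
  rw [LPA.vertex, ← map_zero (LPA.mk E k), LPA.mk_eq_mk_iff, sub_zero] at h
  have hker : E.leavittIdeal k ≤ TwoSidedIdeal.ker (branchingRep E k θ) := by
    rw [leavittIdeal, TwoSidedIdeal.span_le]
    rintro _ ⟨c, y, hy, rfl⟩
    rw [SetLike.mem_coe, TwoSidedIdeal.mem_ker, map_smul, branchingRep_relator k hs hθ hy,
      smul_zero]
  have h0 := (TwoSidedIdeal.mem_ker _).1 (hker h)
  have := congrArg (fun f => f (Finsupp.single (v, 0) (1 : k))) h0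
  simp [branchingRep_gen, branchingGen_vertex] at this

end DirGraph

namespace DirGraph

variable {V D : Type*} (E : DirGraph V D)

/-! ### Boundary paths -/

/-- Paths from a vertex of a given length, or of smaller length if they end in a sink. -/
inductive BPath : ℕ → V → Type _
  | nil (v : V) : BPath 0 v
  | sink (n : ℕ) (v : V) (h : E.IsSink v) : BPath (n + 1) v
  | cons (n : ℕ) (v : V) (e : D) (h : E.s e = v) (p : BPath n (E.r e)) : BPath (n + 1) v

namespace BPath

variable {E}

/-- The last vertex of a boundary path. -/
def endpt : {n : ℕ} → {v : V} → E.BPath n v → V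
  | _, _, nil v => v
  | _, _, sink _ v _ => v
  | _, _, cons _ _ _ _ p => p.endpt

/-- The difference between the prescribed and the actual length of a boundary path. -/
def rem : {n : ℕ} → {v : V} → E.BPath n v → ℕ
  | _, _, nil _ => 0
  | _, _, sink n _ _ => n + 1
  | _, _, cons _ _ _ _ p => p.rem

section Sums

variable (E)

theorem subsingleton_zero (v : V) : Subsingleton (E.BPath 0 v) :=
  ⟨fun p q => by cases p; cases q; rfl⟩

variable {E}

theorem subsingleton_of_isSink {v : V} (hv : E.IsSink v) (n : ℕ) :
    Subsingleton (E.BPath n v) := by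
  refine ⟨fun p q => ?_⟩
  cases p with
  | nil => cases q; rfl
  | sink =>
    cases q with
    | sink => rfl
    | cons _ _ e h => exact absurd h (hv e)
  | cons _ _ e h => exact absurd h (hv e)

/-- Boundary paths from a regular vertex, by their first edge. -/
def consEquiv {v : V} (hv : ¬ E.IsSink v) (n : ℕ) :
    (Σ e : {e : D // E.s e = v}, E.BPath n (E.r e.1)) ≃ E.BPath (n + 1) v where
  toFun x := cons n v x.1.1 x.1.2 x.2
  invFun
    | sink _ _ h => absurd h hv
    | cons _ _ e h p => ⟨⟨e, h⟩, p⟩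
  left_inv _ := rfl
  right_inv p := by
    cases p with
    | sink _ _ h => exact absurd h hv
    | cons => rfl

theorem finite (hE : E.RowFinite) (n : ℕ) (v : V) : Finite (E.BPath n v) := by
  induction n generalizing v with
  | zero => have := subsingleton_zero E v; infer_instance
  | succ n ih =>
    by_cases hv : E.IsSink v
    · have := subsingleton_of_isSink hv (n + 1); infer_instance
    · have : Finite {e : D // E.s e = v} := (hE v).to_subtype
      exact Finite.of_equiv _ (consEquiv hv n)

variable [∀ n v, Fintype (E.BPath n v)] {M : Type*} [AddCommMonoid M]

theorem sum_zero (v : V) (f : E.BPath 0 v → M) : ∑ p, f p = f (nil v) := by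
  have := subsingleton_zero E v
  rw [Fintype.sum_subsingleton f (nil v)]

theorem sum_sink {v : V} (hv : E.IsSink v) (n : ℕ) (f : E.BPath (n + 1) v → M) :
    ∑ p, f p = f (sink n v hv) := by
  have := subsingleton_of_isSink hv (n + 1)
  rw [Fintype.sum_subsingleton f (sink n v hv)]

theorem sum_succ {v : V} (hv : ¬ E.IsSink v) [Fintype {e : D // E.s e = v}] (n : ℕ)
    (f : E.BPath (n + 1) v → M) :
    ∑ p, f p = ∑ e : {e : D // E.s e = v}, ∑ p, f (cons n v e.1 e.2 p) := by
  rw [← (consEquiv hv n).sum_comp, Fintype.sum_sigma]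
  rfl

end Sums

/-! ### Boundary paths as orthogonal partial isometries in the algebra. -/

variable (k : Type*) [Field k]

/-- The product of the edges of a path in `L_k(E)`. -/
noncomputable def elem : {n : ℕ} → {v : V} → E.BPath n v → E.LPA k
  | _, _, nil v => LPA.vertex E k v
  | _, _, sink _ v _ => LPA.vertex E k v
  | _, _, cons _ _ e _ p => LPA.edge E k e * p.elem

/-- The product of the ghost edges of a path in `L_k(E)`, in reverse order. -/
noncomputable def star : {n : ℕ} → {v : V} → E.BPath n v → E.LPA k
  | _, _, nil v => LPA.vertex E k v
  | _, _, sink _ v _ => LPA.vertex E k v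
  | _, _, cons _ _ e _ p => p.star * LPA.ghost E k e

variable {n : ℕ} {v : V}

theorem vertex_mul_elem (p : E.BPath n v) : LPA.vertex E k v * p.elem k = p.elem k := by
  cases p with
  | nil => exact LPA.vertex_idem E k _
  | sink => exact LPA.vertex_idem E k _
  | cons n _ e h p => subst h; rw [elem, ← mul_assoc, LPA.source_mul_edge]

theorem star_mul_vertex (p : E.BPath n v) : p.star k * LPA.vertex E k v = p.star k := by
  cases p with
  | nil => exact LPA.vertex_idem E k _
  | sink => exact LPA.vertex_idem E k _
  | cons n _ e h p => subst h; rw [star, mul_assoc, LPA.ghost_mul_source]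

theorem star_mul_elem_self (p : E.BPath n v) :
    p.star k * p.elem k = LPA.vertex E k p.endpt := by
  induction p with
  | nil => exact LPA.vertex_idem E k _
  | sink => exact LPA.vertex_idem E k _
  | cons n _ e h p ih =>
    rw [star, elem, endpt, mul_assoc, ← mul_assoc _ _ (p.elem k), LPA.ghost_mul_self,
      vertex_mul_elem, ih]

theorem star_mul_elem_of_ne {p q : E.BPath n v} (hpq : p ≠ q) : p.star k * q.elem k = 0 := by
  induction p with
  | nil => cases q; exact absurd rfl hpq
  | sink n v h =>
    cases q with
    | sink => exact absurd rfl hpq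
    | cons _ _ e he => exact absurd he (h e)
  | cons n v e he p ih =>
    cases q with
    | sink _ _ h => exact absurd he (h e)
    | cons _ _ f hf q =>
      rw [star, elem, mul_assoc, ← mul_assoc _ _ (q.elem k)]
      by_cases hef : e = f
      · subst hef
        rw [LPA.ghost_mul_self, vertex_mul_elem]
        exact ih fun h => hpq (by rw [h])
      · rw [LPA.ghost_mul_of_ne E k hef, zero_mul, mul_zero]

theorem elem_mem (p : E.BPath n v) : p.elem k ∈ LPA.component E k (n - p.rem) := by
  induction p with
  | nil => simpa [elem, rem] using LPA.vertex_mem E k _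
  | sink => simpa [elem, rem] using LPA.vertex_mem E k _
  | cons n v e h p ih =>
    have := SetLike.GradedMul.mul_mem (LPA.edge_mem E k e) ih
    rw [elem, rem]
    convert this using 2
    push_cast
    ring

theorem star_mem (p : E.BPath n v) : p.star k ∈ LPA.component E k (p.rem - n) := by
  induction p with
  | nil => simpa [star, rem] using LPA.vertex_mem E k _
  | sink => simpa [star, rem] using LPA.vertex_mem E k _
  | cons n v e h p ih =>
    have := SetLike.GradedMul.mul_mem ih (LPA.ghost_mem E k e)
    rw [star, rem]
    convert this using 2
    push_cast
    ring

/-- Iterates the expansion of regular vertices; branches that have reached a sink stay as they are.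
-/
theorem sum_elem_mul_star [∀ n v, Fintype (E.BPath n v)] [∀ v, Fintype {e : D // E.s e = v}]
    (n : ℕ) (v : V) : ∑ p : E.BPath n v, p.elem k * p.star k = LPA.vertex E k v := by
  induction n generalizing v with
  | zero => rw [sum_zero]; exact LPA.vertex_idem E k v
  | succ n ih =>
    by_cases hv : E.IsSink v
    · rw [sum_sink hv]; exact LPA.vertex_idem E k v
    · rw [sum_succ hv, ← LPA.sum_edge_mul_ghost E k hv]
      refine Finset.sum_congr rfl fun e _ => ?_
      calc ∑ p : E.BPath n (E.r e.1), (cons n v e.1 e.2 p).elem k * (cons n v e.1 e.2 p).star k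
          = LPA.edge E k e.1 * (∑ p : E.BPath n (E.r e.1), p.elem k * p.star k) *
              LPA.ghost E k e.1 := by
            rw [Finset.mul_sum, Finset.sum_mul]
            exact Finset.sum_congr rfl fun p _ => by simp only [elem, star, mul_assoc]
        _ = LPA.edge E k e.1 * LPA.ghost E k e.1 := by rw [ih, LPA.edge_mul_range]

/-! Compression of an element by sufficiently long boundary paths gives a scalar. -/

/-- The ghost path `p*` absorbs the word from the left: an edge cancels the first edge of `p` or
gives zero, a ghost edge lengthens `p` at its start or gives zero, a vertex does nothing or gives
zero. The end of `p` is never touched, and the length bound ensures that `p` is not used up before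
the word. -/
theorem star_mul_listMul_elem (l : List (Gen V D)) {n m : ℕ} {v w : V} (p : E.BPath n v)
    (q : E.BPath m w) (hl : l.length ≤ n) (hd : (n : ℤ) - m = (l.map Gen.degree).sum) :
    ∃ c : k, p.star k * LPA.listMul E k l (q.elem k) = c • LPA.vertex E k p.endpt ∧
      (c ≠ 0 → p.endpt = q.endpt ∧ p.rem = q.rem) := by
  induction l generalizing n v with
  | nil =>
    -- With no letters left, the degree condition makes the two lengths equal, so orthogonality of
    -- boundary paths applies.
    obtain rfl : n = m := by simpa [sub_eq_zero] using hd
    change ∃ c : k, p.star k * q.elem k = _ ∧ _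
    by_cases hvw : v = w
    · subst hvw
      by_cases hpq : p = q
      · subst hpq
        exact ⟨1, by rw [star_mul_elem_self, one_smul], fun _ => ⟨rfl, rfl⟩⟩
      · exact ⟨0, by rw [star_mul_elem_of_ne k hpq, zero_smul], fun h => absurd rfl h⟩
    · refine ⟨0, ?_, fun h => absurd rfl h⟩
      rw [← star_mul_vertex, ← vertex_mul_elem, mul_assoc, ← mul_assoc (LPA.vertex E k v),
        LPA.vertex_mul_of_ne E k hvw, zero_mul, mul_zero, zero_smul]
  | cons g l ih =>
    have hcons : LPA.listMul E k (g :: l) (q.elem k) =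
      LPA.ofGen E k g * LPA.listMul E k l (q.elem k) := rfl
    rw [hcons, ← mul_assoc]
    rw [List.length_cons] at hl
    rw [List.map_cons, List.sum_cons] at hd
    have hzero : p.star k * LPA.ofGen E k g = 0 → ∃ c : k,
        p.star k * LPA.ofGen E k g * LPA.listMul E k l (q.elem k) =
          c • LPA.vertex E k p.endpt ∧ (c ≠ 0 → p.endpt = q.endpt ∧ p.rem = q.rem) := fun h =>
      ⟨0, by rw [h, zero_mul, zero_smul], fun h => absurd rfl h⟩
    cases g with
    | vertex u =>
      by_cases hu : v = u
      · subst hu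
        change ∃ c : k, p.star k * LPA.vertex E k v * _ = _ ∧ _
        rw [star_mul_vertex]
        exact ih p (by omega) (by simpa [Gen.degree] using hd)
      · apply hzero
        change p.star k * LPA.vertex E k u = 0
        rw [← star_mul_vertex, mul_assoc, LPA.vertex_mul_of_ne E k hu, mul_zero]
    | edge e =>
      change p.star k * LPA.edge E k e = 0 → _ at hzero
      change ∃ c : k, p.star k * LPA.edge E k e * _ = _ ∧ _
      cases p with
      -- Excluded by the length bound: a letter remains, so `p` has positive prescribed length.
      | nil => omega
      | sink n v h =>
        apply hzero
        rw [star, ← LPA.source_mul_edge, ← mul_assoc,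
          LPA.vertex_mul_of_ne E k (h e).symm, zero_mul]
      | cons n v f hf p =>
        by_cases hef : f = e
        · subst hef
          rw [star, mul_assoc (p.star k), LPA.ghost_mul_self, star_mul_vertex]
          refine ih p (by omega) ?_
          simp only [Gen.degree] at hd
          push_cast at hd
          linarith
        · apply hzero
          rw [star, mul_assoc, LPA.ghost_mul_of_ne E k hef, mul_zero]
    | ghost e =>
      change p.star k * LPA.ghost E k e = 0 → _ at hzero
      change ∃ c : k, p.star k * LPA.ghost E k e * _ = _ ∧ _
      by_cases hv : v = E.r e
      · subst hv
        refine ih (BPath.cons n _ e rfl p) (by omega) ?_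
        simp only [Gen.degree] at hd
        push_cast
        linarith
      · apply hzero
        rw [← star_mul_vertex, ← LPA.range_mul_ghost, mul_assoc,
          ← mul_assoc (LPA.vertex E k v), LPA.vertex_mul_of_ne E k hv, zero_mul, mul_zero]

/-- The element is a finite sum of signed multiples of words, and a bound on their lengths serves as
`N`. -/
theorem exists_star_mul_mul_elem {d : ℤ} {x : E.LPA k} (hx : x ∈ LPA.component E k d) :
    ∃ N : ℕ, ∀ (n m : ℕ), N ≤ n → (n : ℤ) - m = d → ∀ (v w : V) (p : E.BPath n v)
      (q : E.BPath m w), ∃ c : k, p.star k * x * q.elem k = c • LPA.vertex E k p.endpt ∧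
        (c ≠ 0 → p.endpt = q.endpt ∧ p.rem = q.rem) := by
  induction hx using AddSubgroup.closure_induction with
  | zero => exact ⟨0, fun _ _ _ _ _ _ _ _ => ⟨0, by simp, fun h => absurd rfl h⟩⟩
  | add x y _ _ hx hy =>
    obtain ⟨N, hN⟩ := hx
    obtain ⟨N', hN'⟩ := hy
    refine ⟨max N N', fun n m hn hd v w p q => ?_⟩
    obtain ⟨c, hc, h⟩ := hN n m ((le_max_left _ _).trans hn) hd v w p q
    obtain ⟨c', hc', h'⟩ := hN' n m ((le_max_right _ _).trans hn) hd v w p q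
    refine ⟨c + c', by rw [mul_add, add_mul, hc, hc', add_smul], fun hne => ?_⟩
    by_cases h0 : c = 0
    · exact h' fun h1 => hne (by rw [h0, h1, add_zero])
    · exact h h0
  | neg x _ hx =>
    obtain ⟨N, hN⟩ := hx
    refine ⟨N, fun n m hn hd v w p q => ?_⟩
    obtain ⟨c, hc, h⟩ := hN n m hn hd v w p q
    exact ⟨-c, by rw [mul_neg, neg_mul, hc, neg_smul], fun hne => h (by simpa using hne)⟩
  | mem x hx =>
    obtain ⟨c, w, hw, rfl⟩ := hx
    refine ⟨(w.head :: w.tail).length, fun n m hn hd _ _ p q => ?_⟩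
    obtain ⟨c', hc', h⟩ := star_mul_listMul_elem k (w.head :: w.tail) p q hn
      (by rw [hd, ← hw, LPA.wordDegree_eq])
    refine ⟨c * c', ?_, fun hne => h (right_ne_zero_of_mul hne)⟩
    rw [mul_assoc, LPA.mk_single_mul, mul_smul_comm, hc', smul_smul]

end BPath

end DirGraph

/-! ### Matrices that respect labels -/

namespace Matrix

variable {O ι κ μ k : Type*}

/-- The entries of a matrix between indices with distinct labels vanish. -/
def RespectsLabels [Zero k] (a : ι → O) (b : κ → O) (c : Matrix ι κ k) : Prop :=
  ∀ i j, a i ≠ b j → c i j = 0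

variable {a : ι → O} {b : κ → O}

/-- Restriction to the block of one label is multiplicative, because terms passing through another
label vanish. This reduces label-respecting matrices to ordinary ones. -/
theorem RespectsLabels.submatrix_mul [Semiring k] [Fintype κ] {c : Matrix ι κ k}
    (hc : c.RespectsLabels a b) (d : Matrix κ μ k) {ν : Type*} (g : ν → μ) (o : O)
    [Fintype {j // b j = o}] :
    c.submatrix (Subtype.val : {i // a i = o} → ι) (Subtype.val : {j // b j = o} → κ) *
        d.submatrix (Subtype.val : {j // b j = o} → κ) g =
      (c * d).submatrix Subtype.val g := by
  classical
  ext ⟨i, hi⟩ l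
  simp only [mul_apply, submatrix_apply]
  rw [← Finset.sum_filter_of_ne (p := fun j => b j = o)]
  · exact (Finset.sum_subtype (Finset.univ.filter fun j => b j = o) (by simp)
      fun j => c i j * d j (g l)).symm
  · intro j _ hj
    by_contra h
    exact hj (by rw [hc i j (by rw [hi]; exact Ne.symm h), zero_mul])

/-- An idempotent factors through its range: `x` is the inclusion and `y` the projection, in a basis
of the range. -/
theorem exists_split_of_idem {n k : Type*} [Field k] [Fintype n] [DecidableEq n]
    {c : Matrix n n k} (hc : c * c = c) :
    ∃ (r : ℕ) (x : Matrix n (Fin r) k) (y : Matrix (Fin r) n k), x * y = c ∧ y * x = 1 := by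
  let f := Matrix.toLin' c
  have hf : ∀ z, f (f z) = f z := fun z => by
    simp only [f, Matrix.toLin'_apply, Matrix.mulVec_mulVec, hc]
  let W := LinearMap.range f
  let B := Module.finBasis k W
  let x := LinearMap.toMatrix B (Pi.basisFun k n) W.subtype
  let y := LinearMap.toMatrix (Pi.basisFun k n) B f.rangeRestrict
  refine ⟨_, x, y, ?_, ?_⟩
  · rw [← LinearMap.toMatrix_comp, ← LinearMap.toMatrix'_toLin' c]
    rfl
  · rw [← LinearMap.toMatrix_comp, ← LinearMap.toMatrix_id B]
    congr 1
    ext ⟨_, z, rfl⟩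
    exact congrFun (hf z) _

theorem exists_split_of_respectsLabels {O ι k : Type*} [Field k] [Fintype ι] [DecidableEq ι]
    {a : ι → O} {c : Matrix ι ι k} (hl : c.RespectsLabels a a) (hc : c * c = c) :
    ∃ (r : ℕ) (b : Fin r → O) (x : Matrix ι (Fin r) k) (y : Matrix (Fin r) ι k),
      x.RespectsLabels a b ∧ y.RespectsLabels b a ∧ x * y = c ∧ y * x = 1 := by
  classical
  have hsplit : ∀ o : O, ∃ (r : ℕ) (x : Matrix {i // a i = o} (Fin r) k)
      (y : Matrix (Fin r) {i // a i = o} k),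
      x * y = c.submatrix Subtype.val Subtype.val ∧ y * x = 1 := fun o =>
    exists_split_of_idem (by rw [hl.submatrix_mul, hc])
  choose r x y hxy hyx using hsplit
  -- Each diagonal block is split separately; only labels that occur are used, which keeps the index
  -- type finite.
  let σ := Σ o : Finset.univ.image a, Fin (r o)
  let X : Matrix ι σ k := of fun i s => if h : a i = s.1 then x s.1 ⟨i, h⟩ s.2 else 0
  let Y : Matrix σ ι k := of fun s i => if h : a i = s.1 then y s.1 s.2 ⟨i, h⟩ else 0
  have hXl : X.RespectsLabels a fun s : σ => (s.1 : O) := fun i s h => dif_neg h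
  have hYl : Y.RespectsLabels (fun s : σ => (s.1 : O)) a := fun s i h => dif_neg (Ne.symm h)
  have hXY : X * Y = c := by
    ext i j
    rw [mul_apply, Fintype.sum_sigma,
      Finset.sum_eq_single (⟨a i, Finset.mem_image_of_mem a (Finset.mem_univ i)⟩ :
        {o // o ∈ Finset.univ.image a})]
    · by_cases h : a j = a i
      · simp only [X, Y, of_apply, dif_pos, h]
        have := congrFun (congrFun (hxy (a i)) ⟨i, rfl⟩) ⟨j, h⟩
        rw [mul_apply] at this
        exact this
      · rw [hl i j (Ne.symm h)]
        exact Finset.sum_eq_zero fun s _ => by simp [Y, h]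
    · intro o _ ho
      refine Finset.sum_eq_zero fun s _ => ?_
      have : a i ≠ o := fun h => ho (Subtype.ext h.symm)
      simp [X, this]
    · simp
  have hYX : Y * X = 1 := by
    ext ⟨o, s⟩ ⟨o', s'⟩
    rw [mul_apply]
    by_cases ho : o = o'
    · subst ho
      have h1 := congrFun (congrFun (hyx o) s) s'
      rw [mul_apply] at h1
      rw [← Finset.sum_filter_of_ne (p := fun i => a i = o),
        Finset.sum_subtype (p := fun i => a i = o) _ (by simp)]
      · simp only [one_apply, Sigma.mk.injEq, heq_eq_eq, true_and] at h1 ⊢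
        rw [← h1]
        refine Finset.sum_congr rfl fun i _ => ?_
        simp [X, Y, i.2]
      · intro i _ hi
        by_contra h
        exact hi (by simp [X, h])
    · rw [one_apply_ne fun h => ho (congrArg Sigma.fst h)]
      refine Finset.sum_eq_zero fun i _ => ?_
      by_cases h : a i = o
      · have : a i ≠ o' := fun h' => ho (Subtype.ext (h.symm.trans h'))
        simp [X, this]
      · simp [Y, h]
  let e := Fintype.equivFin σ
  refine ⟨_, fun i => ((e.symm i).1 : O), X.submatrix id e.symm, Y.submatrix e.symm id,
    fun i j h => hXl _ _ h, fun i j h => hYl _ _ h, ?_, ?_⟩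
  · rw [← submatrix_mul _ _ _ _ _ e.symm.bijective, hXY, submatrix_id_id]
  · rw [← submatrix_mul _ _ _ _ _ Function.bijective_id, hYX, submatrix_one_equiv]

/-- Each block of a label-respecting invertible matrix is itself invertible, hence square, so every
label has the same multiplicity on both sides. -/
theorem exists_equiv_of_respectsLabels {O ι κ k : Type*} [Field k] [Fintype ι] [DecidableEq ι]
    [Fintype κ] [DecidableEq κ] {a : ι → O} {b : κ → O} {x : Matrix ι κ k} {y : Matrix κ ι k}
    (hx : x.RespectsLabels a b) (hy : y.RespectsLabels b a) (hxy : x * y = 1) (hyx : y * x = 1) :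
    ∃ e : ι ≃ κ, ∀ i, b (e i) = a i := by
  classical
  have hcard : ∀ o : O, Fintype.card {i // a i = o} = Fintype.card {j // b j = o} := fun o => by
    refine Matrix.square_of_invertible (x.submatrix Subtype.val Subtype.val)
      (y.submatrix Subtype.val Subtype.val) ?_ ?_
    · rw [hx.submatrix_mul, hxy, submatrix_one _ Subtype.val_injective]
    · rw [hy.submatrix_mul, hyx, submatrix_one _ Subtype.val_injective]
  let e := (Equiv.sigmaFiberEquiv a).symm.trans ((Equiv.sigmaCongrRight fun o =>
    Fintype.equivOfCardEq (hcard o)).trans (Equiv.sigmaFiberEquiv b))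
  exact ⟨e, fun i => (Fintype.equivOfCardEq (hcard (a i)) ⟨i, rfl⟩).2⟩

end Matrix

/-! ### Diagonal idempotents as sums of classes in `𝒱^gr`. -/

namespace GradedK

variable {A : Type*} [NonUnitalRing A] {𝒜 : ℤ → AddSubgroup A}

/-- The `1 × 1` matrix with entry `u`. -/
def GrIdem.single (u : A) (h0 : u ∈ 𝒜 0) (hu : u * u = u) (i : ℤ) : GrIdem 𝒜 where
  size := 1
  shift := fun _ => i
  mat := Matrix.of fun _ _ => u
  homog := fun _ _ => by simpa using h0
  idem := by ext i j; simp [Matrix.mul_apply, hu]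

theorem isHomog_diagonal {ι : Type*} [DecidableEq ι] (u : ι → A) (h0 : ∀ t, u t ∈ 𝒜 0)
    (d : ι → ℤ) : IsHomog 𝒜 d d (Matrix.diagonal u) := by
  intro s t
  by_cases h : s = t
  · subst h; simpa using h0 s
  · rw [Matrix.diagonal_apply_ne _ h]; exact zero_mem _

theorem diagonal_idem {ι : Type*} [Fintype ι] [DecidableEq ι] (u : ι → A)
    (hu : ∀ t, u t * u t = u t) : Matrix.diagonal u * Matrix.diagonal u = Matrix.diagonal u := by
  rw [Matrix.diagonal_mul_diagonal]
  exact congrArg _ (funext hu)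

variable [SetLike.GradedMul 𝒜]

theorem VGr.sum_single_fin {n : ℕ} (u : Fin n → A) (h0 : ∀ t, u t ∈ 𝒜 0)
    (hu : ∀ t, u t * u t = u t) (d : Fin n → ℤ) :
    ∑ t, VGr.mk (GrIdem.single (u t) (h0 t) (hu t) (d t)) =
      VGr.mk (𝒜 := 𝒜) ⟨n, d, Matrix.diagonal u, isHomog_diagonal u h0 d, diagonal_idem u hu⟩ := by
  induction n with
  | zero =>
    rw [Finset.univ_eq_empty, Finset.sum_empty]
    refine VGr.mk_eq_mk ⟨0, 0, fun i => i.elim0, fun i => i.elim0, ?_, ?_⟩ <;>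
      (ext i; exact i.elim0)
  | succ n ih =>
    rw [Fin.sum_univ_castSucc, ih, VGr.mk_add_mk]
    refine VGr.mk_eq_mk ?_
    refine (GrIdem.add_mvn _ _).trans (GrIdem.idem _) (diagonal_idem u hu) ?_
    have h := MvN.reindex (finSumFinEquiv (m := n) (n := 1)) (isHomog_diagonal (𝒜 := 𝒜) u h0 d)
      (diagonal_idem u hu)
    have e1 : d ∘ finSumFinEquiv (m := n) (n := 1) =
        Sum.elim (fun i => d i.castSucc) fun _ => d (Fin.last n) := by
      ext (i | i)
      · rfl
      · fin_cases i; rfl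
    have e2 : (Matrix.diagonal u).submatrix (finSumFinEquiv (m := n) (n := 1)) finSumFinEquiv =
        Matrix.fromBlocks (Matrix.diagonal fun i => u i.castSucc) 0 0
          (Matrix.of fun _ _ => u (Fin.last n)) := by
      ext (i | i) (j | j)
      · simp [Matrix.diagonal_apply, Fin.ext_iff]
        rfl
      · have hj : i.castSucc ≠ Fin.last n := (Fin.castSucc_lt_last i).ne
        fin_cases j; exact Matrix.diagonal_apply_ne u hj
      · have hj : Fin.last n ≠ j.castSucc := (Fin.castSucc_lt_last j).ne'
        fin_cases i; exact Matrix.diagonal_apply_ne u hj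
      · fin_cases i; fin_cases j; exact Matrix.diagonal_apply_eq u (Fin.last n)
    rw [e1, e2] at h
    exact h

theorem VGr.mk_eq_sum_single {ι : Type*} [Fintype ι] [DecidableEq ι] (u : ι → A)
    (h0 : ∀ t, u t ∈ 𝒜 0) (hu : ∀ t, u t * u t = u t) (d : ι → ℤ) (p : GrIdem 𝒜)
    (h : MvN 𝒜 p.shift p.mat d (Matrix.diagonal u)) :
    VGr.mk p = ∑ t, VGr.mk (GrIdem.single (u t) (h0 t) (hu t) (d t)) := by
  let e := (Fintype.equivFin ι).symm
  rw [← e.sum_comp, VGr.sum_single_fin (fun t => u (e t)) (fun t => h0 _) (fun t => hu _)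
    (fun t => d (e t))]
  refine VGr.mk_eq_mk (h.trans p.idem (diagonal_idem _ fun t => hu _) ?_)
  have h' := (MvN.reindex e (isHomog_diagonal (𝒜 := 𝒜) u h0 d) (diagonal_idem u hu)).symm
  rwa [Matrix.submatrix_diagonal_equiv] at h'

/-- Equality in the monoid, before group completion, is graded equivalence itself, so no
stabilisation occurs. -/
theorem VGr.mvn_of_sum_single_eq {ι κ : Type*} [Fintype ι] [DecidableEq ι] [Fintype κ]
    [DecidableEq κ] (u : ι → A) (h0 : ∀ t, u t ∈ 𝒜 0) (hu : ∀ t, u t * u t = u t) (d : ι → ℤ)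
    (u' : κ → A) (h0' : ∀ t, u' t ∈ 𝒜 0) (hu' : ∀ t, u' t * u' t = u' t) (d' : κ → ℤ)
    (h : ∑ t, VGr.mk (GrIdem.single (u t) (h0 t) (hu t) (d t)) =
      ∑ t, VGr.mk (GrIdem.single (u' t) (h0' t) (hu' t) (d' t))) :
    MvN 𝒜 d (Matrix.diagonal u) d' (Matrix.diagonal u') := by
  let e := (Fintype.equivFin ι).symm
  let e' := (Fintype.equivFin κ).symm
  rw [← e.sum_comp, ← e'.sum_comp, VGr.sum_single_fin (fun t => u (e t)) (fun t => h0 _)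
    (fun t => hu _) (fun t => d (e t)), VGr.sum_single_fin (fun t => u' (e' t)) (fun t => h0' _)
    (fun t => hu' _) (fun t => d' (e' t))] at h
  have h1 := MvN.reindex e (isHomog_diagonal (𝒜 := 𝒜) u h0 d) (diagonal_idem u hu)
  have h2 := MvN.reindex e' (isHomog_diagonal (𝒜 := 𝒜) u' h0' d') (diagonal_idem u' hu')
  rw [Matrix.submatrix_diagonal_equiv] at h1 h2
  have h3 : MvN 𝒜 (d ∘ e) (Matrix.diagonal (u ∘ e)) (d' ∘ e') (Matrix.diagonal (u' ∘ e')) :=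
    Quotient.exact h
  exact (h1.symm.trans (diagonal_idem _ hu) (diagonal_idem _ fun t => hu' _) h3).trans
    (diagonal_idem _ hu) (diagonal_idem _ hu') h2

end GradedK

namespace DirGraph

open GradedK Filter

variable {V D : Type*} (E : DirGraph V D) (k : Type*) [Field k]

/-! ### Scalar matrices over a Leavitt path algebra -/

/-- The diagonal matrix of a family of vertices. -/
noncomputable def diagV {ι : Type*} [DecidableEq ι] (a : ι → V × ℤ) : Matrix ι ι (E.LPA k) :=
  Matrix.diagonal fun t => LPA.vertex E k (a t).1

variable {k} in
/-- The matrix whose entries are scalar multiples of vertices. -/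
noncomputable def scalarMat {ι κ : Type*} (a : ι → V × ℤ) (c : Matrix ι κ k) :
    Matrix ι κ (E.LPA k) :=
  Matrix.of fun i j => c i j • LPA.vertex E k (a i).1

section Scalar

variable {E k} {ι κ μ : Type*} {a : ι → V × ℤ} {b : κ → V × ℤ}

theorem scalarMat_apply (c : Matrix ι κ k) (i : ι) (j : κ) :
    E.scalarMat a c i j = c i j • LPA.vertex E k (a i).1 := rfl

/-- Where an entry of `c` is nonzero the row and column vertices coincide, so the two vertices
multiply to one. -/
theorem scalarMat_mul [Fintype κ] {c : Matrix ι κ k} (hc : c.RespectsLabels a b)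
    (d : Matrix κ μ k) : E.scalarMat a c * E.scalarMat b d = E.scalarMat a (c * d) := by
  ext i j
  rw [Matrix.mul_apply, scalarMat_apply, Matrix.mul_apply, Finset.sum_smul]
  refine Finset.sum_congr rfl fun t _ => ?_
  rw [scalarMat_apply, scalarMat_apply, smul_mul_assoc, mul_smul_comm, smul_smul]
  by_cases h : a i = b t
  · rw [h, LPA.vertex_idem]
  · rw [hc i t h, zero_mul, zero_smul, zero_smul]

theorem RowFinite.scalarMat_injective (hE : E.RowFinite) :
    Function.Injective (E.scalarMat (κ := κ) (k := k) a) := by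
  intro c d h
  ext i j
  have := congrFun (congrFun h i) j
  exact smul_left_injective k (hE.vertex_ne_zero k _) this

theorem scalarMat_one [DecidableEq ι] : E.scalarMat a (1 : Matrix ι ι k) = E.diagV k a := by
  ext i j
  by_cases h : i = j
  · subst h; simp [scalarMat, diagV]
  · simp [scalarMat, diagV, h]

theorem scalarMat_homog {c : Matrix ι κ k} (hc : c.RespectsLabels a b) :
    IsHomog (LPA.component E k) (fun i => (a i).2) (fun j => (b j).2) (E.scalarMat a c) := by
  intro i j
  by_cases h : a i = b j
  · simp only [h, sub_self]
    exact LPA.smul_mem_component _ (LPA.vertex_mem E k _)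
  · rw [scalarMat_apply, hc i j h, zero_smul]
    exact zero_mem _

theorem diagV_idem [Fintype ι] [DecidableEq ι] : E.diagV k a * E.diagV k a = E.diagV k a :=
  diagonal_idem _ fun _ => LPA.vertex_idem E k _

end Scalar

/-! ### Refinement of families of vertices -/

/-- The boundary paths starting from a family of shifted vertices, down to level `l`. -/
abbrev Refinement {ι : Type*} (a : ι → V × ℤ) (l : ℤ) : Type _ :=
  Σ t : ι, E.BPath ((a t).2 - l).toNat (a t).1

namespace Refinement

variable {E} {ι κ : Type*} {a : ι → V × ℤ} {b : κ → V × ℤ} {l : ℤ}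

/-- The shifted vertex at the end of a boundary path. -/
def label (s : E.Refinement a l) : V × ℤ := (s.2.endpt, l + s.2.rem)

variable (E) [DecidableEq ι] [DecidableEq κ]

/-- The matrix of the boundary paths. -/
noncomputable def toBoundary (a : ι → V × ℤ) (l : ℤ) : Matrix ι (E.Refinement a l) (E.LPA k) :=
  Matrix.of fun t s => if t = s.1 then s.2.elem k else 0

/-- The matrix of the duals of the boundary paths. -/
noncomputable def fromBoundary (a : ι → V × ℤ) (l : ℤ) : Matrix (E.Refinement a l) ι (E.LPA k) :=
  Matrix.of fun s t => if s.1 = t then s.2.star k else 0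

variable {E}

theorem toBoundary_homog (hl : ∀ t, l ≤ (a t).2) :
    IsHomog (LPA.component E k) (fun t => (a t).2) (fun s => (label s).2)
      (toBoundary E k a l) := by
  intro t s
  rw [toBoundary, Matrix.of_apply]
  split_ifs with h
  · subst h
    have := s.2.elem_mem k
    rw [Int.toNat_of_nonneg (sub_nonneg.2 (hl s.1))] at this
    rwa [sub_sub] at this
  · exact zero_mem _

theorem fromBoundary_homog (hl : ∀ t, l ≤ (a t).2) :
    IsHomog (LPA.component E k) (fun s => (label s).2) (fun t => (a t).2)
      (fromBoundary E k a l) := by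
  intro s t
  rw [fromBoundary, Matrix.of_apply]
  split_ifs with h
  · subst h
    have := s.2.star_mem k
    rw [Int.toNat_of_nonneg (sub_nonneg.2 (hl s.1))] at this
    convert this using 2
    simp only [label]
    ring
  · exact zero_mem _

theorem fromBoundary_mul_mul_toBoundary [Fintype ι] [Fintype κ] (M : Matrix ι κ (E.LPA k))
    (l l' : ℤ) (s : E.Refinement a l) (t : E.Refinement b l') :
    (fromBoundary E k a l * M * toBoundary E k b l') s t =
      s.2.star k * M s.1 t.1 * t.2.elem k := by
  simp [Matrix.mul_apply, fromBoundary, toBoundary, ite_mul, mul_ite]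

theorem eventually_exists_scalarMat [Fintype ι] [Fintype κ] {M : Matrix ι κ (E.LPA k)}
    (hM : IsHomog (LPA.component E k) (fun i => (a i).2) (fun j => (b j).2) M) :
    ∀ᶠ l in atBot, ∃ c : Matrix (E.Refinement a l) (E.Refinement b l) k,
      c.RespectsLabels label label ∧
        fromBoundary E k a l * M * toBoundary E k b l = E.scalarMat label c := by
  -- Finitely many entries impose finitely many bounds, all met once `l` is low enough. The
  -- difference of the two path lengths is the degree of the entry, whatever `l` is.
  choose N hN using fun i j => BPath.exists_star_mul_mul_elem k (hM i j)
  have h1 : ∀ᶠ l in atBot, ∀ i j, l ≤ (a i).2 - N i j :=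
    eventually_all.2 fun i => eventually_all.2 fun j => eventually_le_atBot _
  have h2 : ∀ᶠ l in atBot, ∀ j, l ≤ (b j).2 := eventually_all.2 fun j => eventually_le_atBot _
  filter_upwards [h1, h2] with l h1 h2
  have h : ∀ (s : E.Refinement a l) (t : E.Refinement b l), ∃ c : k,
      s.2.star k * M s.1 t.1 * t.2.elem k = c • LPA.vertex E k s.2.endpt ∧
        (c ≠ 0 → s.2.endpt = t.2.endpt ∧ s.2.rem = t.2.rem) := by
    intro s t
    have h1' := h1 s.1 t.1
    have h2' := h2 t.1
    refine hN s.1 t.1 _ _ (by omega) ?_ _ _ s.2 t.2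
    dsimp only
    omega
  choose c hc hcl using h
  refine ⟨Matrix.of c, fun s t hst => ?_, ?_⟩
  · by_contra hne
    obtain ⟨e1, e2⟩ := hcl s t hne
    exact hst (by rw [label, label, e1, e2])
  · ext s t
    rw [fromBoundary_mul_mul_toBoundary, hc]
    rfl

open Classical in
theorem fromBoundary_mul_toBoundary [Fintype ι] :
    fromBoundary E k a l * toBoundary E k a l = E.diagV k (label (a := a) (l := l)) := by
  ext ⟨i, p⟩ ⟨j, q⟩
  have h : (fromBoundary E k a l * toBoundary E k a l) ⟨i, p⟩ ⟨j, q⟩ =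
      if i = j then p.star k * q.elem k else 0 := by
    simp [Matrix.mul_apply, fromBoundary, toBoundary, ite_mul, mul_ite]
  rw [h]
  by_cases hij : i = j
  · subst hij
    rw [if_pos rfl]
    by_cases hpq : p = q
    · subst hpq
      rw [BPath.star_mul_elem_self, diagV, Matrix.diagonal_apply_eq]
      rfl
    · rw [BPath.star_mul_elem_of_ne k hpq, diagV, Matrix.diagonal_apply_ne]
      simpa using hpq
  · rw [if_neg hij, diagV, Matrix.diagonal_apply_ne]
    exact fun h => hij (congrArg Sigma.fst h)

theorem toBoundary_mul_fromBoundary [Fintype ι] [∀ n v, Fintype (E.BPath n v)]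
    [∀ v, Fintype {e : D // E.s e = v}] :
    toBoundary E k a l * fromBoundary E k a l = E.diagV k a := by
  ext i j
  rw [Matrix.mul_apply, Fintype.sum_sigma, Finset.sum_eq_single i]
  · simp only [toBoundary, fromBoundary, Matrix.of_apply, if_true]
    by_cases h : i = j
    · subst h
      simp only [if_true, diagV, Matrix.diagonal_apply_eq]
      exact BPath.sum_elem_mul_star k _ _
    · simp [h, diagV]
  · intro t _ ht
    exact Finset.sum_eq_zero fun p _ => by simp [toBoundary, ht.symm]
  · simp

end Refinement

end DirGraph

/-! ### Compression of idempotent matrices. -/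

namespace GradedK

variable {A : Type*} [NonUnitalRing A] {𝒜 : ℤ → AddSubgroup A} [SetLike.GradedMul 𝒜]

theorem MvN.compress {m n : Type*} [Fintype m] [Fintype n] {δ : m → ℤ} {ε : n → ℤ}
    {M : Matrix m m A} {P : Matrix m n A} {Q : Matrix n m A} (hM : M * M = M)
    (hh : IsHomog 𝒜 δ δ M) (hP : IsHomog 𝒜 δ ε P) (hQ : IsHomog 𝒜 ε δ Q)
    (h : P * Q * M = M) : MvN 𝒜 δ M ε (Q * M * P) := by
  refine ⟨M * P, Q * M, hh.mul hP, hQ.mul hh, ?_, ?_⟩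
  · calc M * P * (Q * M) = M * (P * Q * M) := by simp only [Matrix.mul_assoc]
      _ = M := by rw [h, hM]
  · calc Q * M * (M * P) = Q * (M * M) * P := by simp only [Matrix.mul_assoc]
      _ = Q * M * P := by rw [hM]

theorem compress_idem {m n : Type*} [Fintype m] [Fintype n]
    {M : Matrix m m A} {P : Matrix m n A} {Q : Matrix n m A} (hM : M * M = M)
    (h : P * Q * M = M) : Q * M * P * (Q * M * P) = Q * M * P := by
  calc Q * M * P * (Q * M * P) = Q * (M * (P * Q * M)) * P := by simp only [Matrix.mul_assoc]
    _ = Q * M * P := by rw [h, hM]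

end GradedK

/-! ### Generators and relations for the graded Grothendieck group. -/

namespace DirGraph

open GradedK Filter

variable {V D : Type*} (E : DirGraph V D) (k : Type*) [Field k]

/-- The class of a shifted vertex in `𝒱^gr(L_k(E))`. -/
noncomputable def vertexVGr (o : V × ℤ) : VGr (LPA.component E k) :=
  VGr.mk (GrIdem.single (LPA.vertex E k o.1) (LPA.vertex_mem E k o.1) (LPA.vertex_idem E k o.1) o.2)

theorem vertexClass_eq_of (v : V) (i : ℤ) :
    E.vertexClass k v i = Algebra.GrothendieckAddGroup.of (E.vertexVGr k (v, i)) := rfl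

variable {E}

/-- The row of edges leaving `v` and the column of their ghosts implement the equivalence; their
degrees `1` and `-1` account for the shift. -/
theorem vertexVGr_succ {v : V} (hv : ¬ E.IsSink v) [Fintype {e : D // E.s e = v}] (i : ℤ) :
    E.vertexVGr k (v, i + 1) = ∑ e : {e : D // E.s e = v}, E.vertexVGr k (E.r e.1, i) := by
  classical
  refine VGr.mk_eq_sum_single (fun e : {e : D // E.s e = v} => LPA.vertex E k (E.r e.1))
    (fun e => LPA.vertex_mem E k _) (fun e => LPA.vertex_idem E k _) (fun _ => i) _ ?_
  change MvN _ (fun _ : Fin 1 => i + 1) (Matrix.of fun _ _ : Fin 1 => LPA.vertex E k v) _ _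
  refine ⟨Matrix.of fun _ e => LPA.edge E k e.1, Matrix.of fun e _ => LPA.ghost E k e.1,
    fun _ e => ?_, fun e _ => ?_, ?_, ?_⟩
  · rw [add_sub_cancel_left]
    exact LPA.edge_mem E k e.1
  · rw [sub_add_cancel_left]
    exact LPA.ghost_mem E k e.1
  · ext _ _
    exact LPA.sum_edge_mul_ghost E k hv
  · ext e f
    simp only [Matrix.mul_apply, Matrix.of_apply, Finset.univ_unique,
      Finset.sum_const, Finset.card_singleton, one_smul]
    by_cases h : e = f
    · subst h
      rw [Matrix.diagonal_apply_eq, LPA.ghost_mul_self]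
    · rw [Matrix.diagonal_apply_ne _ h, LPA.ghost_mul_of_ne E k fun h' => h (Subtype.ext h')]

/-- Every idempotent homogeneous matrix that lives on a family of vertices is equivalent to the
diagonal matrix of a family of vertices. -/
theorem RowFinite.exists_mvn_diagV_of_le (hE : E.RowFinite) {ι : Type*} [Fintype ι]
    [DecidableEq ι] {a : ι → V × ℤ} {M : Matrix ι ι (E.LPA k)}
    (hh : IsHomog (LPA.component E k) (fun i => (a i).2) (fun i => (a i).2) M)
    (hM : M * M = M) (ha : E.diagV k a * M = M) :
    ∃ (r : ℕ) (b : Fin r → V × ℤ), MvN (LPA.component E k) (fun i => (a i).2) M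
      (fun i => (b i).2) (E.diagV k b) := by
  classical
  have (n : ℕ) (v : V) : Fintype (E.BPath n v) :=
    have := BPath.finite hE n v
    Fintype.ofFinite _
  have (v : V) : Fintype {e : D // E.s e = v} :=
    have : Finite {e : D // E.s e = v} := (hE v).to_subtype
    Fintype.ofFinite _
  have hl : ∀ᶠ l in atBot, ∀ t, l ≤ (a t).2 := eventually_all.2 fun t => eventually_le_atBot _
  obtain ⟨l, ⟨c, hc, hM'⟩, hl⟩ := ((Refinement.eventually_exists_scalarMat k hh).and hl).exists
  have hPQ : Refinement.toBoundary E k a l * Refinement.fromBoundary E k a l * M = M := by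
    rw [Refinement.toBoundary_mul_fromBoundary, ha]
  have h1 := MvN.compress hM hh (Refinement.toBoundary_homog k hl)
    (Refinement.fromBoundary_homog k hl) hPQ
  have h2 := compress_idem hM hPQ
  rw [hM'] at h1 h2
  rw [scalarMat_mul hc] at h2
  -- Since vertices are nonzero, the scalar matrix is itself idempotent, so it splits over `k`
  -- compatibly with labels.
  obtain ⟨r, b, x, y, hx, hy, hxy, hyx⟩ := Matrix.exists_split_of_respectsLabels hc
    (hE.scalarMat_injective h2)
  refine ⟨r, b, h1.trans hM diagV_idem ⟨E.scalarMat _ x, E.scalarMat _ y, scalarMat_homog hx,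
    scalarMat_homog hy, ?_, ?_⟩⟩
  · rw [scalarMat_mul hx, hxy]
  · rw [scalarMat_mul hy, hyx, scalarMat_one]

/-- Every idempotent homogeneous matrix is equivalent to the diagonal matrix of a family of
vertices. -/
theorem RowFinite.exists_mvn_diagV (hE : E.RowFinite) (p : GrIdem (LPA.component E k)) :
    ∃ (r : ℕ) (b : Fin r → V × ℤ), MvN (LPA.component E k) p.shift p.mat
      (fun i => (b i).2) (E.diagV k b) := by
  classical
  choose X hX using fun i j => LPA.exists_localUnit (p.mat i j)
  -- One finite set of vertices whose sum is a left unit for all entries; it replaces the missing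
  -- identity of the algebra.
  let Y := Finset.univ.biUnion fun i => Finset.univ.biUnion fun j => X i j
  have hY : ∀ i j, (∑ v ∈ Y, LPA.vertex E k v) * p.mat i j = p.mat i j := fun i j =>
    (hX i j Y ((Finset.subset_biUnion_of_mem (fun j => X i j) (Finset.mem_univ j)).trans
      (Finset.subset_biUnion_of_mem (fun i => Finset.univ.biUnion fun j => X i j)
        (Finset.mem_univ i)))).1
  let a : Fin p.size × Y → V × ℤ := fun t => (t.2, p.shift t.1)
  let P : Matrix (Fin p.size) (Fin p.size × Y) (E.LPA k) :=
    Matrix.of fun i t => if i = t.1 then LPA.vertex E k t.2 else 0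
  let Q : Matrix (Fin p.size × Y) (Fin p.size) (E.LPA k) :=
    Matrix.of fun t i => if i = t.1 then LPA.vertex E k t.2 else 0
  have hP : IsHomog (LPA.component E k) p.shift (fun t => (a t).2) P := by
    intro i t
    simp only [P, Matrix.of_apply]
    split_ifs with h
    · subst h; simpa [a] using LPA.vertex_mem E k _
    · exact zero_mem _
  have hQ : IsHomog (LPA.component E k) (fun t => (a t).2) p.shift Q := by
    intro t i
    simp only [Q, Matrix.of_apply]
    split_ifs with h
    · subst h; simpa [a] using LPA.vertex_mem E k _
    · exact zero_mem _
  have hPQ : P * Q * p.mat = p.mat := by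
    have : P * Q = Matrix.diagonal fun _ => ∑ v ∈ Y, LPA.vertex E k v := by
      ext i j
      rw [Matrix.mul_apply, Fintype.sum_prod_type, Finset.sum_eq_single i]
      · by_cases h : i = j
        · subst h
          simp only [P, Q, Matrix.of_apply, if_true, LPA.vertex_idem, Matrix.diagonal_apply_eq]
          exact Finset.sum_coe_sort Y fun v => LPA.vertex E k v
        · simp [P, Q, h, Ne.symm h]
      · intro t _ ht
        exact Finset.sum_eq_zero fun v _ => by simp [P, ht.symm]
      · simp
    rw [this]
    ext i j
    rw [Matrix.diagonal_mul, hY]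
  have hQa : E.diagV k a * Q = Q := by
    ext t i
    rw [diagV, Matrix.diagonal_mul]
    simp [Q, a, LPA.vertex_idem]
  have h1 := MvN.compress p.idem p.homog hP hQ hPQ
  have hidem := compress_idem p.idem hPQ
  obtain ⟨r, b, h2⟩ := hE.exists_mvn_diagV_of_le k ((hQ.mul p.homog).mul hP) hidem
    (by rw [← Matrix.mul_assoc, ← Matrix.mul_assoc, hQa])
  exact ⟨r, b, h1.trans p.idem diagV_idem h2⟩

theorem RowFinite.exists_eq_sum_vertexVGr (hE : E.RowFinite) (x : VGr (LPA.component E k)) :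
    ∃ (r : ℕ) (b : Fin r → V × ℤ), x = ∑ t, E.vertexVGr k (b t) := by
  induction x using Quotient.ind with | _ p
  obtain ⟨r, b, h⟩ := hE.exists_mvn_diagV k p
  exact ⟨r, b, VGr.mk_eq_sum_single _ (fun t => LPA.vertex_mem E k _)
    (fun t => LPA.vertex_idem E k _) _ p h⟩

/-- A function on shifted vertices that satisfies the relations of the graded Grothendieck
group. -/
def RespectsEdges {G : Type*} [AddCommMonoid G] [∀ v, Fintype {e : D // E.s e = v}]
    (f : V × ℤ → G) : Prop :=
  ∀ v, ¬ E.IsSink v → ∀ i, f (v, i + 1) = ∑ e : {e : D // E.s e = v}, f (E.r e.1, i)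

-- Compression to level `l` preserves products, since going from the family to its boundary paths
-- and back is the identity on the family. Mutually inverse `x`, `y` thus give mutually inverse
-- scalar matrices.
open Classical in
theorem RowFinite.mul_eq_one_of_mvn (hE : E.RowFinite) [∀ v, Fintype {e : D // E.s e = v}]
    [∀ n v, Fintype (E.BPath n v)] {ι κ : Type*} [Fintype ι] [DecidableEq ι] [Fintype κ]
    [DecidableEq κ] {a : ι → V × ℤ} {b : κ → V × ℤ} {l : ℤ} {x : Matrix ι κ (E.LPA k)}
    {y : Matrix κ ι (E.LPA k)} (hxy : x * y = E.diagV k a) (hyx : y * x = E.diagV k b)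
    {c : Matrix (E.Refinement a l) (E.Refinement b l) k}
    {d : Matrix (E.Refinement b l) (E.Refinement a l) k}
    (hc : c.RespectsLabels Refinement.label Refinement.label)
    (hcx : Refinement.fromBoundary E k a l * x * Refinement.toBoundary E k b l =
      E.scalarMat Refinement.label c)
    (hdy : Refinement.fromBoundary E k b l * y * Refinement.toBoundary E k a l =
      E.scalarMat Refinement.label d) : c * d = 1 := by
  refine hE.scalarMat_injective (a := Refinement.label) ?_
  rw [← scalarMat_mul hc, ← hcx, ← hdy, scalarMat_one]
  calc _ = Refinement.fromBoundary E k a l * (x * (Refinement.toBoundary E k b l *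
          Refinement.fromBoundary E k b l) * y) * Refinement.toBoundary E k a l := by
        simp only [Matrix.mul_assoc]
    _ = Refinement.fromBoundary E k a l * ((x * y) * (x * y)) *
          Refinement.toBoundary E k a l := by
        rw [Refinement.toBoundary_mul_fromBoundary, ← hyx]
        simp only [Matrix.mul_assoc]
    _ = Refinement.fromBoundary E k a l * (Refinement.toBoundary E k a l *
          Refinement.fromBoundary E k a l) * Refinement.toBoundary E k a l := by
        rw [hxy, diagV_idem, Refinement.toBoundary_mul_fromBoundary]
    _ = (Refinement.fromBoundary E k a l * Refinement.toBoundary E k a l) *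
          (Refinement.fromBoundary E k a l * Refinement.toBoundary E k a l) := by
        simp only [Matrix.mul_assoc]
    _ = _ := by
        rw [Refinement.fromBoundary_mul_toBoundary, diagV_idem]

section Invariance

variable [∀ v, Fintype {e : D // E.s e = v}] {G : Type*} [AddCommMonoid G] {f : V × ℤ → G}

theorem BPath.sum_label [∀ n v, Fintype (E.BPath n v)] (hf : E.RespectsEdges f) (l : ℤ) (n : ℕ)
    (v : V) : ∑ p : E.BPath n v, f (p.endpt, l + p.rem) = f (v, l + n) := by
  induction n generalizing v with
  | zero => rw [sum_zero]; rfl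
  | succ n ih =>
    by_cases hv : E.IsSink v
    · rw [sum_sink hv]; rfl
    · rw [sum_succ hv, Nat.cast_succ, ← add_assoc, hf v hv]
      exact Finset.sum_congr rfl fun e _ => ih _

theorem Refinement.sum_label [∀ n v, Fintype (E.BPath n v)] (hf : E.RespectsEdges f)
    {ι : Type*} [Fintype ι] {a : ι → V × ℤ} {l : ℤ} (hl : ∀ t, l ≤ (a t).2) :
    ∑ s : E.Refinement a l, f (label s) = ∑ t, f (a t) := by
  rw [Fintype.sum_sigma]
  refine Finset.sum_congr rfl fun t _ => (BPath.sum_label hf l _ _).trans ?_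
  rw [Int.toNat_of_nonneg (sub_nonneg.2 (hl t)), add_sub_cancel]

/-- Refining both families to a common low level leaves the sums of `f` unchanged. There the
equivalence becomes an invertible label-respecting matrix over `k`, so the refined families agree up
to reordering. -/
theorem RowFinite.sum_eq_of_mvn (hE : E.RowFinite) (hf : E.RespectsEdges f)
    {ι κ : Type*} [Fintype ι] [DecidableEq ι] [Fintype κ] [DecidableEq κ] {a : ι → V × ℤ}
    {b : κ → V × ℤ} (h : MvN (LPA.component E k) (fun t => (a t).2) (E.diagV k a)
      (fun t => (b t).2) (E.diagV k b)) : ∑ t, f (a t) = ∑ t, f (b t) := by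
  classical
  have (n : ℕ) (v : V) : Fintype (E.BPath n v) :=
    have := BPath.finite hE n v
    Fintype.ofFinite _
  obtain ⟨x, y, hx, hy, hxy, hyx⟩ := h
  have ha : ∀ᶠ l in atBot, ∀ t, l ≤ (a t).2 := eventually_all.2 fun t => eventually_le_atBot _
  have hb : ∀ᶠ l in atBot, ∀ t, l ≤ (b t).2 := eventually_all.2 fun t => eventually_le_atBot _
  obtain ⟨l, ⟨⟨⟨c, hc, hcx⟩, ⟨d, hd, hdy⟩⟩, ha⟩, hb⟩ :=
    ((((Refinement.eventually_exists_scalarMat k hx).and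
      (Refinement.eventually_exists_scalarMat k hy)).and ha).and hb).exists
  obtain ⟨e, he⟩ := Matrix.exists_equiv_of_respectsLabels hc hd
    (hE.mul_eq_one_of_mvn k hxy hyx hc hcx hdy)
    (hE.mul_eq_one_of_mvn k hyx hxy hd hdy hcx)
  rw [← Refinement.sum_label hf ha, ← Refinement.sum_label hf hb, ← e.sum_comp]
  exact Finset.sum_congr rfl fun s _ => by rw [he]

theorem RowFinite.sum_eq_of_sum_vertexVGr_eq (hE : E.RowFinite) (hf : E.RespectsEdges f)
    {ι κ : Type*} [Fintype ι] [Fintype κ] {a : ι → V × ℤ}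
    {b : κ → V × ℤ} (h : ∑ t, E.vertexVGr k (a t) = ∑ t, E.vertexVGr k (b t)) :
    ∑ t, f (a t) = ∑ t, f (b t) := by
  classical
  exact hE.sum_eq_of_mvn k hf (VGr.mvn_of_sum_single_eq _ (fun t => LPA.vertex_mem E k _)
    (fun t => LPA.vertex_idem E k _) _ _ (fun t => LPA.vertex_mem E k _)
    (fun t => LPA.vertex_idem E k _) _ h)

end Invariance

/-- The universal property of the graded Grothendieck group of a Leavitt path algebra. -/
theorem RowFinite.exists_hom (hE : E.RowFinite) [∀ v, Fintype {e : D // E.s e = v}]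
    {G : Type*} [AddCommGroup G] {f : V × ℤ → G} (hf : E.RespectsEdges f) :
    ∃ Φ : E.K0GrLPA k →+ G, ∀ v i, Φ (E.vertexClass k v i) = f (v, i) := by
  choose r b hb using hE.exists_eq_sum_vertexVGr k
  -- The value does not depend on the chosen decomposition into vertices, which yields additivity.
  have key : ∀ {ι : Type} [Fintype ι] (a : ι → V × ℤ) x, x = ∑ t, E.vertexVGr k (a t) →
      ∑ t, f (b x t) = ∑ t, f (a t) := fun a x hx =>
    hE.sum_eq_of_sum_vertexVGr_eq k hf ((hb x).symm.trans hx)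
  let F : VGr (LPA.component E k) →+ G :=
    { toFun := fun x => ∑ t, f (b x t)
      map_zero' := by
        rw [key (Fin.elim0 : Fin 0 → V × ℤ) 0 (by simp)]
        simp
      map_add' := fun x y => by
        rw [key (Sum.elim (b x) (b y)) (x + y)]
        · simp
        · rw [Fintype.sum_sum_type]
          exact congrArg₂ _ (hb x) (hb y) }
  refine ⟨Algebra.GrothendieckAddGroup.lift F, fun v i => ?_⟩
  have : F (E.vertexVGr k (v, i)) = f (v, i) := by
    change ∑ t, f (b _ t) = _
    rw [key (fun _ : Fin 1 => (v, i)) _ (by simp)]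
    simp
  rw [vertexClass_eq_of, ← this]
  exact DFunLike.congr_fun (Algebra.GrothendieckAddGroup.lift.symm_apply_apply F) _

theorem RowFinite.hom_ext (hE : E.RowFinite) {G : Type*} [AddCommGroup G]
    {f g : E.K0GrLPA k →+ G} (h : ∀ v i, f (E.vertexClass k v i) = g (E.vertexClass k v i)) :
    f = g := by
  refine Algebra.GrothendieckAddGroup.lift.symm.injective (AddMonoidHom.ext fun x => ?_)
  obtain ⟨r, b, rfl⟩ := hE.exists_eq_sum_vertexVGr k x
  rw [map_sum, map_sum]
  exact Finset.sum_congr rfl fun t _ => h _ _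

end DirGraph

/-! ### Kernel and cokernel of the shift on a one-relator-per-generator quotient -/

namespace GradedK

section Shift

variable {U W : Type*} [AddCommGroup U] [AddCommGroup W]

/-- `z ↦ t j(z) - a(z)` on finitely supported families, where `t` raises the index by one. -/
noncomputable def shiftSub (j a : U →+ W) : (ℤ →₀ U) →+ (ℤ →₀ W) :=
  (Finsupp.mapDomain.addMonoidHom (· + 1)).comp (Finsupp.mapRange.addMonoidHom j) -
    Finsupp.mapRange.addMonoidHom a

theorem shiftSub_single (j a : U →+ W) (i : ℤ) (u : U) :
    shiftSub j a (Finsupp.single i u) =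
      Finsupp.single (i + 1) (j u) - Finsupp.single i (a u) := by
  simp [shiftSub, Finsupp.mapDomain.addMonoidHom]

/-- The leading coefficient of `(t·j - a) z` is `j` of the leading coefficient of `z`. -/
theorem shiftSub_injective {j : U →+ W} (hj : Function.Injective j) (a : U →+ W) :
    Function.Injective (shiftSub j a) := by
  rw [injective_iff_map_eq_zero]
  intro z hz
  by_contra hne
  have hs : z.support.Nonempty := Finsupp.support_nonempty_iff.2 hne
  set n := z.support.max' hs with hn
  have h0 : z (n + 1) = 0 := by
    by_contra h
    have := z.support.le_max' (n + 1) (Finsupp.mem_support_iff.2 h)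
    omega
  have h1 := DFunLike.congr_fun hz (n + 1)
  have h2 : Finsupp.mapDomain (· + 1) (Finsupp.mapRange.addMonoidHom j z) (n + 1) =
      Finsupp.mapRange.addMonoidHom j z n :=
    Finsupp.mapDomain_apply (add_left_injective 1) _ n
  have h3 : j (z n) - a (z (n + 1)) = 0 := by
    refine Eq.trans ?_ h1
    simp only [shiftSub, AddMonoidHom.sub_apply, Finsupp.sub_apply, AddMonoidHom.comp_apply]
    change _ = Finsupp.mapDomain (· + 1) (Finsupp.mapRange.addMonoidHom j z) (n + 1) - _
    rw [h2]
    rfl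
  rw [h0, map_zero, sub_zero, map_eq_zero_iff j hj] at h3
  exact Finsupp.mem_support_iff.1 (z.support.max'_mem hs) h3

/-- The total sum of a finitely supported family. -/
noncomputable def total : (ℤ →₀ W) →+ W := Finsupp.liftAddHom fun _ => AddMonoidHom.id W

theorem total_single (i : ℤ) (w : W) : total (Finsupp.single i w) = w := by simp [total]

theorem total_shiftSub (j a : U →+ W) (z : ℤ →₀ U) :
    total (shiftSub j a z) = j (total z) - a (total z) := by
  induction z using Finsupp.induction_linear with
  | zero => simp
  | add x y hx hy => simp only [map_add, hx, hy]; abel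
  | single i u => rw [shiftSub_single, map_sub]; simp only [total_single]

/-- Modulo `t - 1` every `t^i w` equals `w`, so evaluation at `t = 1` is the quotient by `t - 1`. -/
theorem exists_shiftSub_id (y : ℤ →₀ W) : ∃ z : ℤ →₀ W,
    y = Finsupp.single 0 (total y) + shiftSub (.id W) (.id W) z := by
  induction y using Finsupp.induction_linear with
  | zero => exact ⟨0, by simp⟩
  | add x y hx hy =>
    obtain ⟨z, hz⟩ := hx
    obtain ⟨z', hz'⟩ := hy
    refine ⟨z + z', ?_⟩
    conv_lhs => rw [hz, hz']
    rw [map_add, map_add, Finsupp.single_add]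
    abel
  | single i w =>
    rw [total_single]
    induction i using Int.induction_on with
    | zero => exact ⟨0, by simp⟩
    | succ i ih =>
      obtain ⟨z, hz⟩ := ih
      refine ⟨z + Finsupp.single (i : ℤ) w, ?_⟩
      rw [map_add, ← add_assoc, ← hz, shiftSub_single]
      simp
    | pred i ih =>
      obtain ⟨z, hz⟩ := ih
      refine ⟨z - Finsupp.single (-(i : ℤ) - 1) w, ?_⟩
      rw [map_sub, ← add_sub_assoc, ← hz, shiftSub_single]
      simp

theorem shiftSub_comm (j a : U →+ W) (z : ℤ →₀ U) :
    shiftSub (.id W) (.id W) (shiftSub j a z) = shiftSub j a (shiftSub (.id U) (.id U) z) := by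
  induction z using Finsupp.induction_linear with
  | zero => simp
  | add x y hx hy => simp only [map_add, hx, hy]
  | single i u =>
    simp only [shiftSub_single, map_sub, AddMonoidHom.id_apply]
    abel

variable {G : Type*} [AddCommGroup G] {j a : U →+ W} {π : (ℤ →₀ W) →+ G} {φ : G →+ G}

/-- In the quotient `t·j(x) = a(x)`, hence `(t - 1) j(x) = a(x) - j(x)`. -/
theorem phi_zero_component (hker : ∀ z, π (shiftSub j a z) = 0)
    (hφ : ∀ y, φ (π y) = π (shiftSub (.id W) (.id W) y)) (x : U) :
    φ (π (Finsupp.single 0 (j x))) = π (Finsupp.single 0 (a x - j x)) := by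
  have h := hker (Finsupp.single 0 x)
  rw [shiftSub_single, map_sub, sub_eq_zero] at h
  rw [hφ, shiftSub_single, map_sub, AddMonoidHom.id_apply, h, Finsupp.single_sub, map_sub]

theorem eq_zero_of_zero_component (hj : Function.Injective j)
    (hker : ∀ y, π y = 0 → ∃ z, shiftSub j a z = y) {x : U} (hx : a x = j x)
    (h : π (Finsupp.single 0 (j x)) = 0) : x = 0 := by
  obtain ⟨z, hz⟩ := hker _ h
  -- As `a x = j x`, the right side is `(t - 1) j(x)`, and `j(x) = (t·j - a) z`. Cancelling `t·j -
  -- a` gives `x = (t - 1) z`, which vanishes at `t = 1`.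
  have h1 : shiftSub j a (shiftSub (.id U) (.id U) z) = shiftSub j a (Finsupp.single 0 x) := by
    rw [← shiftSub_comm, hz, shiftSub_single, shiftSub_single, hx]
    rfl
  have h2 := congrArg total (shiftSub_injective hj a h1)
  rw [total_shiftSub, total_single, sub_self] at h2
  exact h2.symm

theorem exists_zero_component (hsurj : Function.Surjective π)
    (hker₀ : ∀ z, π (shiftSub j a z) = 0) (hker : ∀ y, π y = 0 → ∃ z, shiftSub j a z = y)
    (hφ : ∀ y, φ (π y) = π (shiftSub (.id W) (.id W) y)) {g : G} (hg : φ g = 0) :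
    ∃ x, a x = j x ∧ π (Finsupp.single 0 (j x)) = g := by
  obtain ⟨y, rfl⟩ := hsurj g
  rw [hφ] at hg
  obtain ⟨z, hz⟩ := hker _ hg
  -- The witness is the connecting map of the snake lemma: `(t - 1) y = (t·j - a) z`, evaluated at
  -- `t = 1`.
  have hx : a (total z) = j (total z) := by
    have := congrArg total hz
    rw [total_shiftSub, total_shiftSub, sub_self, sub_eq_zero] at this
    exact this.symm
  refine ⟨total z, hx, ?_⟩
  obtain ⟨z', hz'⟩ := exists_shiftSub_id z
  -- With `z = x + (t - 1) z'`, both sides are multiples of `t - 1`, which cancels; so `y` and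
  -- `j(x)` differ by a relation.
  have h1 : shiftSub (.id W) (.id W) y =
      shiftSub (.id W) (.id W) (Finsupp.single 0 (j (total z)) + shiftSub j a z') := by
    rw [map_add, shiftSub_comm, ← hz]
    conv_lhs => rw [hz']
    rw [map_add, shiftSub_single, shiftSub_single, hx]
    rfl
  rw [shiftSub_injective Function.injective_id _ h1, map_add, hker₀, add_zero]

theorem exists_zero_component_add (hsurj : Function.Surjective π)
    (hφ : ∀ y, φ (π y) = π (shiftSub (.id W) (.id W) y)) (g : G) :
    ∃ y h, g = π (Finsupp.single 0 y) + φ h := by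
  obtain ⟨y, rfl⟩ := hsurj g
  obtain ⟨z, hz⟩ := exists_shiftSub_id y
  exact ⟨total y, π z, by rw [hφ, ← map_add, ← hz]⟩

theorem exists_of_zero_component_mem_range (hsurj : Function.Surjective π)
    (hker : ∀ y, π y = 0 → ∃ z, shiftSub j a z = y)
    (hφ : ∀ y, φ (π y) = π (shiftSub (.id W) (.id W) y)) {y : W} {g : G}
    (hg : φ g = π (Finsupp.single 0 y)) : ∃ x, a x - j x = y := by
  obtain ⟨y', rfl⟩ := hsurj g
  rw [hφ, ← sub_eq_zero, ← map_sub] at hg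
  obtain ⟨z, hz⟩ := hker _ hg
  -- At `t = 1` the multiple of `t - 1` disappears and `-y = j(x) - a(x)` remains, with `x` the
  -- total of `z`.
  have := congrArg total hz
  rw [map_sub, total_shiftSub, total_shiftSub, total_single, sub_self, zero_sub] at this
  exact ⟨total z, by rw [← neg_sub, this, neg_neg]⟩

end Shift

end GradedK

/-! ### The presentation of the graded Grothendieck group and the final diagram. -/

namespace DirGraph

open GradedK

variable {V D : Type*} {E : DirGraph V D}

/-- `x ↦ (Bᵗ x, Cᵗ x)`. -/
noncomputable def adjHom (hE : E.RowFinite) : (E.R →₀ ℤ) →+ (E.R →₀ ℤ) × (E.S →₀ ℤ) :=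
  (transposeHom E.B hE.B_support).prod (transposeHom E.C hE.C_support)

variable (E) in
open Classical in
/-- The basis vector of `ℤ^R ⊕ ℤ^S` that belongs to a vertex. -/
noncomputable def basisVec (v : V) : (E.R →₀ ℤ) × (E.S →₀ ℤ) :=
  if h : E.IsSink v then (0, Finsupp.single ⟨v, h⟩ 1) else (Finsupp.single ⟨v, h⟩ 1, 0)

theorem basisVec_R (v : E.R) : E.basisVec v.1 = (Finsupp.single v 1, 0) := dif_neg v.2

theorem basisVec_S (v : E.S) : E.basisVec v.1 = (0, Finsupp.single v 1) := dif_pos v.2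

theorem hom_ext_basisVec {G : Type*} [AddCommGroup G]
    {f g : (E.R →₀ ℤ) × (E.S →₀ ℤ) →+ G} (h : ∀ v, f (E.basisVec v) = g (E.basisVec v)) :
    f = g := by
  rw [← AddMonoidHom.coprod_unique f, ← AddMonoidHom.coprod_unique g]
  congr 1
  · ext v
    simpa [basisVec_R] using h v.1
  · ext v
    simpa [basisVec_S] using h v.1

theorem adjHom_single (hE : E.RowFinite) [∀ v, Fintype {e : D // E.s e = v}] (v : E.R) :
    adjHom hE (Finsupp.single v 1) = ∑ e : {e : D // E.s e = v.1}, E.basisVec (E.r e.1) := by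
  classical
  have hcard : ∀ w : V, E.adj v.1 w =
      ∑ e : {e : D // E.s e = v.1}, if E.r e.1 = w then 1 else 0 := by
    intro w
    rw [Finset.sum_boole, adj, ← Fintype.card_subtype, ← Nat.card_eq_fintype_card]
    congr 1
    exact Nat.card_congr (Equiv.subtypeSubtypeEquivSubtypeInter _ _).symm
  refine Prod.ext ?_ ?_
  · ext w
    rw [Prod.fst_sum, Finsupp.finsetSum_apply]
    have : (adjHom hE (Finsupp.single v 1)).1 w = E.adj v.1 w.1 := by
      simp [adjHom, transposeHom, Finsupp.ofSupportFinite, B]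
    rw [this, hcard]
    refine Finset.sum_congr rfl fun e _ => ?_
    by_cases h : E.IsSink (E.r e.1)
    · have hne : E.r e.1 ≠ w.1 := fun h' => w.2 (h' ▸ h)
      simp [basisVec, h, hne]
    · simp [basisVec, h, Finsupp.single_apply, Subtype.ext_iff]
  · ext w
    rw [Prod.snd_sum, Finsupp.finsetSum_apply]
    have : (adjHom hE (Finsupp.single v 1)).2 w = E.adj v.1 w.1 := by
      simp [adjHom, transposeHom, Finsupp.ofSupportFinite, C]
    rw [this, hcard]
    refine Finset.sum_congr rfl fun e _ => ?_
    by_cases h : E.IsSink (E.r e.1)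
    · simp [basisVec, h, Finsupp.single_apply, Subtype.ext_iff]
    · have hne : E.r e.1 ≠ w.1 := fun h' => h (h' ▸ w.2)
      simp [basisVec, h, hne]

variable (E) (k : Type*) [Field k]

/-- `y ↦ y(i) = ∑ v, y_v v(i)`. -/
noncomputable def psiLevel (i : ℤ) : (E.R →₀ ℤ) × (E.S →₀ ℤ) →+ E.K0GrLPA k :=
  AddMonoidHom.coprod
    (Finsupp.liftAddHom fun v => (zmultiplesHom _) (E.vertexClass k v.1 i))
    (Finsupp.liftAddHom fun v => (zmultiplesHom _) (E.vertexClass k v.1 i))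

/-- The presentation of the graded Grothendieck group. -/
noncomputable def presentation : (ℤ →₀ (E.R →₀ ℤ) × (E.S →₀ ℤ)) →+ E.K0GrLPA k :=
  Finsupp.liftAddHom (E.psiLevel k)

variable {E}

theorem psiLevel_basisVec (v : V) (i : ℤ) :
    E.psiLevel k i (E.basisVec v) = E.vertexClass k v i := by
  by_cases h : E.IsSink v
  · simp [psiLevel, basisVec, h]
  · simp [psiLevel, basisVec, h]

theorem presentation_single (i : ℤ) (y : (E.R →₀ ℤ) × (E.S →₀ ℤ)) :
    E.presentation k (Finsupp.single i y) = E.psiLevel k i y := by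
  simp [presentation]

theorem phi_vertexClass (v : V) (i : ℤ) :
    E.phi k (E.vertexClass k v i) = E.vertexClass k v (i + 1) - E.vertexClass k v i := by
  have : K0Gr.translate 1 (E.vertexClass k v i) = E.vertexClass k v (i + 1) :=
    DFunLike.congr_fun (Algebra.GrothendieckAddGroup.lift.symm_apply_apply
      (Algebra.GrothendieckAddGroup.of.comp (VGr.translate 1))) (E.vertexVGr k (v, i))
  rw [phi, AddMonoidHom.sub_apply, this, AddMonoidHom.id_apply]

theorem vertexClass_succ {v : V} (hv : ¬ E.IsSink v) [Fintype {e : D // E.s e = v}] (i : ℤ) :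
    E.vertexClass k v (i + 1) = ∑ e : {e : D // E.s e = v}, E.vertexClass k (E.r e.1) i := by
  rw [vertexClass_eq_of, vertexVGr_succ k hv, map_sum]
  rfl

theorem phi_presentation (y : ℤ →₀ (E.R →₀ ℤ) × (E.S →₀ ℤ)) :
    E.phi k (E.presentation k y) = E.presentation k (shiftSub (.id _) (.id _) y) := by
  induction y using Finsupp.induction_linear with
  | zero => simp
  | add x y hx hy => simp only [map_add, hx, hy]
  | single i y =>
    rw [shiftSub_single, map_sub]
    simp only [presentation_single]
    refine DFunLike.congr_fun (f := (E.phi k).comp (E.psiLevel k i))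
      (g := E.psiLevel k (i + 1) - E.psiLevel k i) (hom_ext_basisVec fun v => ?_) y
    simp only [AddMonoidHom.comp_apply, AddMonoidHom.sub_apply, psiLevel_basisVec,
      phi_vertexClass]

theorem RowFinite.presentation_surjective (hE : E.RowFinite) :
    Function.Surjective (E.presentation k) := by
  rw [← AddMonoidHom.range_eq_top, ← QuotientAddGroup.ker_mk' (E.presentation k).range,
    AddMonoidHom.ker_eq_top_iff]
  refine hE.hom_ext k fun v i => ?_
  rw [← psiLevel_basisVec, ← presentation_single]
  exact (QuotientAddGroup.eq_zero_iff _).2 ⟨_, rfl⟩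

theorem RowFinite.presentation_shiftSub (hE : E.RowFinite) (z : ℤ →₀ E.R →₀ ℤ) :
    E.presentation k (shiftSub (AddMonoidHom.inl _ _) (adjHom hE) z) = 0 := by
  have (v : V) : Fintype {e : D // E.s e = v} :=
    have : Finite {e : D // E.s e = v} := (hE v).to_subtype
    Fintype.ofFinite _
  refine DFunLike.congr_fun (f := (E.presentation k).comp (shiftSub (AddMonoidHom.inl _ _)
    (adjHom hE))) (g := 0) ?_ z
  ext i v
  simp only [AddMonoidHom.comp_apply, Finsupp.singleAddHom_apply, shiftSub_single, map_sub,
    presentation_single, AddMonoidHom.inl_apply, AddMonoidHom.zero_apply, adjHom_single]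
  rw [← basisVec_R, map_sum, psiLevel_basisVec, vertexClass_succ k v.2, sub_eq_zero]
  exact Finset.sum_congr rfl fun e _ => (psiLevel_basisVec k _ _).symm

/-- The quotient by the relations receives a map from the Grothendieck group by the universal
property. Its composite with the presentation is the quotient map, so whatever the presentation
kills is a relation. -/
theorem RowFinite.exists_shiftSub_eq (hE : E.RowFinite)
    (y : ℤ →₀ (E.R →₀ ℤ) × (E.S →₀ ℤ)) (hy : E.presentation k y = 0) :
    ∃ z, shiftSub (AddMonoidHom.inl _ _) (adjHom hE) z = y := by
  have (v : V) : Fintype {e : D // E.s e = v} :=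
    have : Finite {e : D // E.s e = v} := (hE v).to_subtype
    Fintype.ofFinite _
  let N := (shiftSub (AddMonoidHom.inl _ _) (adjHom hE)).range
  let q := QuotientAddGroup.mk' N
  -- The edge relation at `v` and level `i` is the image under `t·j - a` of the basis vector of `v`
  -- at level `i`.
  have hf : E.RespectsEdges fun o : V × ℤ => q (Finsupp.single o.2 (E.basisVec o.1)) := by
    intro v hv i
    change q (Finsupp.single (i + 1) (E.basisVec v)) =
      ∑ e : {e : D // E.s e = v}, q (Finsupp.singleAddHom i (E.basisVec (E.r e.1)))
    rw [← map_sum, ← map_sum, ← adjHom_single hE ⟨v, hv⟩, ← sub_eq_zero, ← map_sub]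
    refine (QuotientAddGroup.eq_zero_iff _).2 ⟨Finsupp.single i (Finsupp.single ⟨v, hv⟩ 1), ?_⟩
    rw [shiftSub_single, AddMonoidHom.inl_apply, ← basisVec_R]
    rfl
  obtain ⟨Φ, hΦ⟩ := hE.exists_hom k hf
  have h : Φ.comp (E.presentation k) = q := by
    refine Finsupp.addHom_ext' fun i => hom_ext_basisVec fun v => ?_
    simp only [AddMonoidHom.comp_apply, Finsupp.singleAddHom_apply, presentation_single,
      psiLevel_basisVec, hΦ]
  have h0 : q y = 0 := by rw [← h, AddMonoidHom.comp_apply, hy, map_zero]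
  exact (QuotientAddGroup.eq_zero_iff y).1 h0

theorem psi_eq (y : (E.R →₀ ℤ) × (E.S →₀ ℤ)) :
    E.psi k y = E.presentation k (Finsupp.single 0 y) := by
  rw [presentation_single]
  rfl

theorem mapK_apply (hE : E.RowFinite) (x : E.R →₀ ℤ) :
    mapK hE x = adjHom hE x - AddMonoidHom.inl _ _ x := by
  simp [mapK, adjHom]

end DirGraph

theorem mainTheorem7 {V D : Type*} (k : Type*) [Field k] (E : DirGraph V D) (hE : E.RowFinite) :
    -- `φ` is the unique homomorphism with `φ(v(i)) = v(i+1) - v(i)`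
    (∀ (v : V) (i : ℤ),
      E.phi k (E.vertexClass k v i) = E.vertexClass k v (i + 1) - E.vertexClass k v i) ∧
    (∀ f : E.K0GrLPA k →+ E.K0GrLPA k,
      (∀ (v : V) (i : ℤ),
        f (E.vertexClass k v i) = E.vertexClass k v (i + 1) - E.vertexClass k v i) →
      f = E.phi k) ∧
    -- the middle square commutes
    (∀ x : E.R →₀ ℤ, E.phi k (E.psi k (x, 0)) = E.psi k (DirGraph.mapK hE x)) ∧
    -- `ψ` restricts to an isomorphism `Ker K ≅ Ker φ`
    (∃ α : (DirGraph.mapK hE).ker ≃+ (E.phi k).ker,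
      ∀ x : (DirGraph.mapK hE).ker, (α x : E.K0GrLPA k) = E.psi k ((x : E.R →₀ ℤ), 0)) ∧
    -- `ψ` induces an isomorphism `Coker K ≅ Coker φ`
    (∃ β : (((E.R →₀ ℤ) × (E.S →₀ ℤ)) ⧸ (DirGraph.mapK hE).range) ≃+
        (E.K0GrLPA k ⧸ (E.phi k).range),
      ∀ y : (E.R →₀ ℤ) × (E.S →₀ ℤ),
        β (QuotientAddGroup.mk y) = QuotientAddGroup.mk (E.psi k y)) := by
  have hj : Function.Injective (AddMonoidHom.inl (E.R →₀ ℤ) (E.S →₀ ℤ)) :=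
    fun x y h => congrArg Prod.fst h
  have hsurj := hE.presentation_surjective k
  have hker₀ := hE.presentation_shiftSub k
  have hker := hE.exists_shiftSub_eq k
  have hφ := DirGraph.phi_presentation (E := E) k
  have hsq : ∀ x : E.R →₀ ℤ, E.phi k (E.psi k (x, 0)) = E.psi k (DirGraph.mapK hE x) := by
    intro x
    rw [DirGraph.psi_eq, DirGraph.psi_eq, DirGraph.mapK_apply]
    exact GradedK.phi_zero_component hker₀ hφ x
  have hmem : ∀ x : E.R →₀ ℤ, DirGraph.mapK hE x = 0 ↔
      DirGraph.adjHom hE x = AddMonoidHom.inl _ _ x := fun x => by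
    rw [DirGraph.mapK_apply, sub_eq_zero]
  refine ⟨DirGraph.phi_vertexClass k, fun f hf => hE.hom_ext k fun v i => ?_, hsq, ?_, ?_⟩
  · rw [hf, DirGraph.phi_vertexClass]
  · let α : (DirGraph.mapK hE).ker →+ (E.phi k).ker :=
      (((E.psi k).comp (AddMonoidHom.inl _ _)).comp (DirGraph.mapK hE).ker.subtype).codRestrict _
        fun x => by
          change E.phi k (E.psi k (x.1, 0)) = 0
          rw [hsq, AddMonoidHom.mem_ker.1 x.2, map_zero]
    have hα : ∀ x, (α x : E.K0GrLPA k) = E.psi k ((x : E.R →₀ ℤ), 0) := fun _ => rfl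
    refine ⟨AddEquiv.ofBijective α ⟨?_, ?_⟩, hα⟩
    · rw [injective_iff_map_eq_zero]
      intro x hx
      have h := congrArg Subtype.val hx
      rw [hα, DirGraph.psi_eq] at h
      exact Subtype.ext (GradedK.eq_zero_of_zero_component hj hker ((hmem _).1 x.2) h)
    · intro g
      obtain ⟨x, hx, hxg⟩ := GradedK.exists_zero_component hsurj hker₀ hker hφ g.2
      refine ⟨⟨x, (hmem x).2 hx⟩, Subtype.ext ?_⟩
      rw [hα, DirGraph.psi_eq]
      exact hxg
  · let β := QuotientAddGroup.map (DirGraph.mapK hE).range (E.phi k).range (E.psi k) (by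
      rintro _ ⟨x, rfl⟩
      exact ⟨_, hsq x⟩)
    refine ⟨AddEquiv.ofBijective β ⟨?_, ?_⟩, fun _ => rfl⟩
    · rw [injective_iff_map_eq_zero]
      intro y hy
      induction y using QuotientAddGroup.induction_on with | _ y
      obtain ⟨g, hg⟩ := (QuotientAddGroup.eq_zero_iff (E.psi k y)).1 hy
      rw [DirGraph.psi_eq] at hg
      obtain ⟨x, hx⟩ := GradedK.exists_of_zero_component_mem_range hsurj hker hφ hg
      exact (QuotientAddGroup.eq_zero_iff y).2 ⟨x, by rw [DirGraph.mapK_apply, hx]⟩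
    · intro g
      induction g using QuotientAddGroup.induction_on with | _ g
      obtain ⟨y, h, rfl⟩ := GradedK.exists_zero_component_add hsurj hφ g
      refine ⟨QuotientAddGroup.mk y, ?_⟩
      change QuotientAddGroup.mk (E.psi k y) = _
      rw [DirGraph.psi_eq, QuotientAddGroup.mk_add,
        (QuotientAddGroup.eq_zero_iff (N := (E.phi k).range) (E.phi k h)).2 ⟨h, rfl⟩, add_zero]
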